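/- Let $H=\mathbb Z\cup\{\infty\}$ with the topology in which every integer is isolated and the sets $U_N=\{N,N+1,\dots,\infty\}$ $(N\in\mathbb Z)$ form a neighbourhood basis of $\infty$. It is a commutative hypergroup with identity element $\infty$, identity involution, and convolution $\varepsilon_n*\varepsilon_n=\sum_{k\ge1}2^{-k}\varepsilon_{n+k}$ for $n\in\mathbb Z$, $\varepsilon_\infty*\varepsilon_\infty=\varepsilon_\infty$, $\varepsilon_x*\varepsilon_y=\varepsilon_{\min\{x,y\}}$ for $x\ne y$. Its Haar measure is $\omega(\{n\})=2^{-(n+1)}$ for $n\in\mathbb Z$, $\omega(\{\infty\})=0$. Its characters are $\chi_{-\infty}\equiv1$ and, for $n\in\mathbb Z$, $\chi_n(x)=0$ if $x\le n-2$, $\chi_n(n-1)=-1$, $\chi_n(x)=1$ if $x\ge n$; identify the dual $\widehat H$ with $\mathbb Z\cup\{-\infty\}$. The Plancherel measure is $\pi(\{\chi_n\})=2^{n-1}$ for $n\in\mathbb Z$, $\pi(\{\chi_{-\infty}\})=0$. A function $f:H\to\mathbb C$ is of positive type if it is locally integrable and $\int f\cdot(g*\overline g)\,d\omega\ge0$ for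 all $g\in C_c(H)$, where $(g*h)(x)=\int\big(\int g\,d(\varepsilon_x*\varepsilon_y)\big)h(y)\,d\omega(y)$. For $1\le p\le\infty$ and $1\le q<\infty$ put $$\|f\|_{p,q}^*=\Big(\sum_{n<0}\omega(\{n\})|f(n)|^q+\|f\mathbf 1_{U_0}\|_{L^p(\omega)}^q\Big)^{1/q},\qquad \|f\|_{p,\infty}^*=\max\Big\{\sup_{n<0}|f(n)|,\ \|f\mathbf 1_{U_0}\|_{L^p(\omega)}\Big\},$$ and let $(L^p,\ell^q)(H)$ be the space of $f$ with $\|f\|^*_{p,q}<\infty$. On $\widehat H$ define $\|\cdot\|_{p,q}^*$ and $(L^p,\ell^q)(\widehat H)$ in the same way, with $\pi$ in place of $\omega$, $\{n\le0\}$ in place of $U_0$, and $\{n>0\}$ in place of $\{n<0\}$. Write $\widehat f(n)=\int f\,\overline{\chi_n}\,d\omega$ and $\check\varphi(x)=\int\varphi(n)\chi_n(x)\,d\pi(n)$. Theorem. (a) For a function $f$ of positive type on $H$ the following are equivalent: (i) $f$ is square integrable in a neighbourhood of the identity; (ii) there are a constant $c\ge0$ and $\varphi\in(L^1,\ell^2)(\widehat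 H)$ with $f=c+\check\varphi$ $\omega$-almost everywhere; (iii) $f\in(L^2,\ell^\infty)(H)$. (b) If moreover $f(n)\to0$ as $n\to-\infty$, then the following are equivalent: (i) $f$ is square integrable in a neighbourhood of the identity; (ii$'$) $f=\check\varphi$ $\omega$-almost everywhere for some $\varphi\in(L^1,\ell^2)(\widehat H)$; (iii) $f\in(L^2,\ell^\infty)(H)$. (c) For $1\le p,q\le2$ with conjugate exponents $p',q'$ and every $f:H\to\mathbb C$ with $\|f\|^*_{p,q}<\infty$, $$\|\widehat f\|^*_{q',p'}\le\|f\|^*_{p,q}.$$ -/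

import Mathlib

open MeasureTheory Filter Topology
open scoped ENNReal ComplexOrder ComplexConjugate

noncomputable section

namespace SpectorHypergroup

/-- The underlying space of the hypergroup: `ℤ ∪ {∞}` with the order topology. Every integer is
isolated, and the sets `U_N = {N, N + 1, …, ∞}` form a basis of (compact) neighbourhoods of the
point `∞ = ⊤`, which is the identity element. It carries Mathlib's Borel σ-algebra (all sets). -/
abbrev H : Type := WithTop ℤ

/-- The index set `ℤ ∪ {-∞}` of the dual: `n` stands for the character `χ_n`. -/
abbrev Hhat : Type := WithBot ℤ

/-- All subsets of the countable dual are measurable. -/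
instance : MeasurableSpace Hhat := ⊤

/-- The convolution `ε_x * ε_x` of a unit point mass with itself:
`ε_n * ε_n = ∑_{k ≥ 1} 2^{-k} ε_{n+k}` for an integer `n`, and `ε_∞ * ε_∞ = ε_∞`. -/
def selfConv : H → Measure H
  | none => Measure.dirac ⊤
  | some n => Measure.sum fun k : ℕ =>
      ENNReal.ofReal ((1 / 2 : ℝ) ^ (k + 1)) • Measure.dirac ((n + (k + 1) : ℤ) : H)

/-- The convolution `ε_x * ε_y` of two unit point masses: `ε_x * ε_y = ε_{min x y}` for `x ≠ y`. -/
def pointConv (x y : H) : Measure H :=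
  if x = y then selfConv x else Measure.dirac (min x y)

/-- The Haar measure: `ω({n}) = 2^{-(n+1)}` for integers `n`, and `ω({∞}) = 0`. -/
def haar : Measure H :=
  Measure.sum fun n : ℤ => ENNReal.ofReal ((2 : ℝ) ^ (-(n + 1))) • Measure.dirac (n : H)

/-- The Plancherel measure on the dual: `π({χ_n}) = 2^{n-1}` for integers `n`, and
`π({χ_{-∞}}) = 0`. -/
def plancherel : Measure Hhat :=
  Measure.sum fun n : ℤ => ENNReal.ofReal ((2 : ℝ) ^ (n - 1)) • Measure.dirac (n : Hhat)

/-- The (real-valued) characters: `χ_{-∞} = 1`, and for an integer `n`,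
`χ_n(x) = 0` if `x ≤ n - 2`, `χ_n(n - 1) = -1`, `χ_n(x) = 1` if `x ≥ n` (including `x = ∞`). -/
def character : Hhat → H → ℂ
  | none, _ => 1
  | some n, x =>
      if ((n : ℤ) : H) ≤ x then 1 else if x = ((n - 1 : ℤ) : H) then -1 else 0

/-- Convolution of functions, `(g * h)(x) = ∫ g(x * y) h(y⁻) dω(y)`, where
`g(x * y) = ∫ g d(ε_x * ε_y)`. The involution `y ↦ y⁻` of this hypergroup is the identity map. -/
def funConv (g h : H → ℂ) (x : H) : ℂ :=
  ∫ y, (∫ z, g z ∂(pointConv x y)) * h y ∂haar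

/-- Functions of positive type: locally integrable `f` with `∫ f · (g * g^*) dω ≥ 0` for all
`g ∈ C_c(H)`. The modular function is `1` and the involution is the identity, so that `g^*` is the
pointwise conjugate of `g`. The order is that of `ℂ`: the integral is real and nonnegative. -/
structure IsPositiveType (f : H → ℂ) : Prop where
  locallyIntegrable : LocallyIntegrable f haar
  integral_nonneg : ∀ g : H → ℂ, Continuous g → HasCompactSupport g →
    0 ≤ ∫ x, f x * funConv g (fun y => conj (g y)) x ∂haar

/-- The modified amalgam norm relative to a block `B`, on a space whose remaining points are
singleton blocks: `max (‖f 1_{Bᶜ}‖_{L^∞(μ)}) (‖f 1_B‖_{L^p(μ)})` if `q = ∞` and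
`(‖f 1_{Bᶜ}‖_{L^q(μ)}^q + ‖f 1_B‖_{L^p(μ)}^q)^{1/q}` if `q < ∞`. -/
def amalgamNorm {X : Type*} [MeasurableSpace X] (μ : Measure X) (B : Set X) (p q : ℝ≥0∞)
    (f : X → ℂ) : ℝ≥0∞ :=
  if q = ∞ then max (eLpNorm f ∞ (μ.restrict Bᶜ)) (eLpNorm f p (μ.restrict B))
  else (eLpNorm f q (μ.restrict Bᶜ) ^ q.toReal + eLpNorm f p (μ.restrict B) ^ q.toReal)
    ^ (1 / q.toReal)

/-- The norm `‖·‖*_{p,q}` on `H`, with the block `U_0 = {0, 1, 2, …, ∞}`. -/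
def normH (p q : ℝ≥0∞) (f : H → ℂ) : ℝ≥0∞ :=
  amalgamNorm haar (Set.Ici 0) p q f

/-- The norm `‖·‖*_{p,q}` on the dual, with the block `U_0^⊥ = {n : n ≤ 0}`. -/
def normHhat (p q : ℝ≥0∞) (φ : Hhat → ℂ) : ℝ≥0∞ :=
  amalgamNorm plancherel (Set.Iic 0) p q φ

/-- The Fourier transform. For an integer `n`, the character `χ_n` is bounded with compact support,
so the integral converges for every locally integrable `f`; the point `-∞` is `π`-null. -/
def fourierH (f : H → ℂ) (n : Hhat) : ℂ :=
  ∫ x, f x * conj (character n x) ∂haar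

/-- The inverse Fourier transform. For an integer `x`, `χ_n(x) = 0` for all `n > x + 1`, so the
integral converges absolutely whenever `φ` is `π`-integrable on each `{n : n ≤ N}`, in particular
for `φ ∈ L^1(π) + L^2(π)`; the point `∞` is `ω`-null. -/
def invFourier (φ : Hhat → ℂ) (x : H) : ℂ :=
  ∫ n, φ n * character n x ∂plancherel

end SpectorHypergroup

end

open SpectorHypergroup

/-! Write `s n` for the integral of `f` over `U_n` and `F n` for its Fourier coefficient at `χ_n`.
Then `s (n - 1)` and `F n` are the sum and the difference of `s n` and `2 ^ (-n) * f (n - 1)`, so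
harmonic analysis on `H` is an iteration of that on `ℤ/2`.

For (c), Clarkson's inequality is Hausdorff–Young on `ℤ/2` with constant one. Iterating it down the
levels, with Minkowski in `ℓ^(q/p)` to carry along what has already been split off, gives
`DyadicRecursion.hausdorffYoung`. Descending from level `L` to `0` treats `U_0`; descending from `0`
treats the quotient by `U_0`. The two estimates share the number `|s 0|`, and one more use of
Minkowski glues them in `normHhat_fourierH_le`.

For (a) and (b), the indicators of the `U_n` and the characters `χ_n` satisfy `g * g^* = ω(supp g)
g`. Hence a function of positive type has `s n ≥ 0` and `F n ≥ 0`. The means `2 ^ n * s n` increase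
by exactly `π({χ_n}) F n` from `n - 1` to `n`; telescoping makes `F` integrable on `{n ≤ 0}` and
gives `f = c + (F)ˇ`, where `c ≥ 0` is the limit of the means at `-∞`
(`exists_eq_const_add_invFourier`). Square integrability near the identity passes to `F` by
Hausdorff–Young with `p = 2`. Conversely, Parseval controls `c + φˇ` on `U_0`, and the `L^1` norm of
`φ` on `{n ≤ 0}` bounds `φˇ` off `U_0`. Since `(F)ˇ` vanishes at `-∞`, so does `c` whenever `f`
does. -/

namespace SpectorHypergroup

/-! ### Scalar inequalities -/

/-- Friedrichs' auxiliary function for Clarkson's inequality is antitone in the parameter. -/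
lemma antitoneOn_clarksonAux {q y : ℝ} (hq : 2 ≤ q) (hy0 : 0 < y) (hy1 : y < 1) :
    AntitoneOn (fun t : ℝ => (1 + t ^ (1 - q) * y) * (1 + t * y) ^ (q - 1) +
      (1 - t ^ (1 - q) * y) * (1 - t * y) ^ (q - 1)) (Set.Ioc 0 1) := by
  have hd : ∀ t ∈ Set.Ioc (0 : ℝ) 1, HasDerivAt
      (fun t : ℝ => (1 + t ^ (1 - q) * y) * (1 + t * y) ^ (q - 1) +
        (1 - t ^ (1 - q) * y) * (1 - t * y) ^ (q - 1))
      ((q - 1) * y * (1 - t ^ (-q)) * ((1 + t * y) ^ (q - 2) - (1 - t * y) ^ (q - 2))) t := by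
    rintro t ⟨ht0, ht1⟩
    have hty : t * y < 1 := by nlinarith
    have h1 : 0 < 1 + t * y := by positivity
    have h2 : 0 < 1 - t * y := by linarith
    have hA : HasDerivAt (fun t : ℝ => t ^ (1 - q)) ((1 - q) * t ^ (1 - q - 1)) t :=
      Real.hasDerivAt_rpow_const (Or.inl ht0.ne')
    have hB : HasDerivAt (fun t : ℝ => (1 + t * y) ^ (q - 1))
        (1 * y * (q - 1) * (1 + t * y) ^ (q - 1 - 1)) t :=
      (((hasDerivAt_id t).mul_const y).const_add 1).rpow_const (Or.inl h1.ne')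
    have hC : HasDerivAt (fun t : ℝ => (1 - t * y) ^ (q - 1))
        (-(1 * y) * (q - 1) * (1 - t * y) ^ (q - 1 - 1)) t :=
      (((hasDerivAt_id t).mul_const y).const_sub 1).rpow_const (Or.inl h2.ne')
    have key := (((hA.mul_const y).const_add 1).mul hB).add
      (((hA.mul_const y).const_sub 1).mul hC)
    refine key.congr_deriv ?_
    have e1 : t ^ (1 - q - 1) = t ^ (-q) := by congr 1; ring
    have e2 : t ^ (1 - q) = t * t ^ (-q) := by
      rw [show (1 - q) = 1 + -q by ring, Real.rpow_add ht0, Real.rpow_one]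
    have e3 : (1 + t * y) ^ (q - 1) = (1 + t * y) * (1 + t * y) ^ (q - 2) := by
      rw [show (q - 1) = 1 + (q - 2) by ring, Real.rpow_add h1, Real.rpow_one]
    have e4 : (1 - t * y) ^ (q - 1) = (1 - t * y) * (1 - t * y) ^ (q - 2) := by
      rw [show (q - 1) = 1 + (q - 2) by ring, Real.rpow_add h2, Real.rpow_one]
    have e5 : q - 1 - 1 = q - 2 := by ring
    rw [e5, e1, e2, e3, e4]
    ring
  refine antitoneOn_of_deriv_nonpos (convex_Ioc 0 1)
    (fun t ht => (hd t ht).continuousAt.continuousWithinAt) ?_ ?_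
  · intro t ht
    exact (hd t (interior_subset ht)).differentiableAt.differentiableWithinAt
  · intro t ht
    have ht' := interior_subset ht
    rw [(hd t ht').deriv]
    have hty : t * y < 1 := by nlinarith [ht'.1, ht'.2]
    have h3 : 1 ≤ t ^ (-q) := Real.one_le_rpow_of_pos_of_le_one_of_nonpos ht'.1 ht'.2 (by linarith)
    have h4 : (1 - t * y) ^ (q - 2) ≤ (1 + t * y) ^ (q - 2) := by
      have := mul_pos ht'.1 hy0
      exact Real.rpow_le_rpow (by linarith) (by linarith) (by linarith)
    have : 0 ≤ (q - 1) * y * (t ^ (-q) - 1) * ((1 + t * y) ^ (q - 2) - (1 - t * y) ^ (q - 2)) :=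
      mul_nonneg (mul_nonneg (mul_nonneg (by linarith) hy0.le) (by linarith)) (by linarith)
    linarith

lemma clarkson_one {p q y : ℝ} (hpq : p.HolderConjugate q) (hq : 2 ≤ q) (hy0 : 0 ≤ y)
    (hy1 : y ≤ 1) : (1 + y) ^ q + (1 - y) ^ q ≤ 2 * (1 + y ^ p) ^ (q / p) := by
  have hp := hpq.lt
  have hqp : q / p = q - 1 := hpq.symm.div_conj_eq_sub_one
  rw [hqp]
  rcases hy0.eq_or_lt with rfl | hy0
  · rw [Real.zero_rpow hpq.pos.ne']; norm_num
  rcases hy1.eq_or_lt with rfl | hy1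
  · have : (1 - 1 : ℝ) ^ q = 0 := by rw [sub_self, Real.zero_rpow hpq.symm.pos.ne']
    rw [this, Real.one_rpow, show (1 + 1 : ℝ) = 2 by norm_num, add_zero]
    conv_lhs => rw [show q = 1 + (q - 1) by ring, Real.rpow_add two_pos, Real.rpow_one]
  have ha0 : 0 < y ^ (p - 1) := Real.rpow_pos_of_pos hy0 _
  have ha1 : y ^ (p - 1) ≤ 1 := Real.rpow_le_one hy0.le hy1.le (by linarith)
  -- At `t = y ^ (p - 1)` the second summand vanishes and the first is `2 * (1 + y ^ p) ^ (q - 1)`;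
  -- at `t = 1` the function is the left-hand side.
  have h := antitoneOn_clarksonAux hq hy0 hy1 ⟨ha0, ha1⟩ ⟨one_pos, le_rfl⟩ ha1
  have e1 : (y ^ (p - 1)) ^ (1 - q) * y = 1 := by
    rw [← Real.rpow_mul hy0.le]
    have : (p - 1) * (1 - q) = -1 := by
      have := hpq.mul_eq_add
      linear_combination -this
    rw [this, Real.rpow_neg_one, inv_mul_cancel₀ hy0.ne']
  have e2 : y ^ (p - 1) * y = y ^ p := by
    conv_rhs => rw [show p = p - 1 + 1 by ring, Real.rpow_add hy0, Real.rpow_one]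
  simp only [e1, e2, Real.one_rpow, one_mul, sub_self, zero_mul, add_zero] at h
  have e3 : ∀ z : ℝ, 0 ≤ z → z * z ^ (q - 1) = z ^ q := by
    intro z hz
    conv_rhs => rw [show q = 1 + (q - 1) by ring, Real.rpow_add' hz (by linarith), Real.rpow_one]
  rw [e3 _ (by linarith), e3 _ (by linarith)] at h
  linarith

lemma clarkson_real {p q a b : ℝ} (hpq : p.HolderConjugate q) (hq : 2 ≤ q) (hb : 0 ≤ b)
    (hab : b ≤ a) : (a + b) ^ q + (a - b) ^ q ≤ 2 * (a ^ p + b ^ p) ^ (q / p) := by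
  have hp := hpq.pos
  have hq0 := hpq.symm.pos
  rcases (hb.trans hab).eq_or_lt with rfl | ha
  · obtain rfl : b = 0 := le_antisymm hab hb
    simp only [add_zero, sub_zero, Real.zero_rpow hq0.ne']
    positivity
  have h := clarkson_one hpq hq (y := b / a) (by positivity) ((div_le_one ha).2 hab)
  have e : 0 ≤ 1 - b / a := sub_nonneg.2 ((div_le_one ha).2 hab)
  have h' := mul_le_mul_of_nonneg_left h (Real.rpow_nonneg ha.le q)
  rw [mul_add, ← Real.mul_rpow ha.le (by positivity), ← Real.mul_rpow ha.le e] at h'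
  have e1 : a ^ q * (2 * (1 + (b / a) ^ p) ^ (q / p)) =
      2 * (a ^ p + b ^ p) ^ (q / p) := by
    have : a ^ p + b ^ p = a ^ p * (1 + (b / a) ^ p) := by
      rw [Real.div_rpow hb ha.le]
      field_simp
    rw [this, Real.mul_rpow (by positivity) (by positivity), ← Real.rpow_mul ha.le,
      mul_div_cancel₀ _ hp.ne']
    ring
  rwa [e1, mul_add, mul_sub, mul_one, mul_div_cancel₀ _ ha.ne'] at h'

/-- The points `u + t` and `u - t` are convex combinations of `u + |s|` and `u - |s|` with the two
weights interchanged, so adding the two convexity inequalities suffices. -/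
lemma rpow_add_rpow_le_of_abs_le {u s r : ℝ} (hr : 1 ≤ r) (hs : |s| ≤ u) {t : ℝ}
    (hst : |t| ≤ |s|) : (u + t) ^ r + (u - t) ^ r ≤ (u + |s|) ^ r + (u - |s|) ^ r := by
  have hu := (abs_nonneg s).trans hs
  rcases (abs_nonneg s).eq_or_lt with h0 | h0
  · rw [← h0] at hst ⊢
    obtain rfl : t = 0 := abs_nonpos_iff.1 hst
    exact le_rfl
  have hc := convexOn_rpow hr
  obtain ⟨ht1, ht2⟩ := abs_le.1 hst
  have hp : (u + |s|) ∈ Set.Ici (0 : ℝ) := by simp; positivity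
  have hm : (u - |s|) ∈ Set.Ici (0 : ℝ) := by simpa using hs
  set l := (1 + t / |s|) / 2 with hl
  set m := (1 - t / |s|) / 2 with hm'
  have hl0 : 0 ≤ l := by
    have : -1 ≤ t / |s| := by rw [le_div_iff₀ h0]; linarith
    rw [hl]; linarith
  have hm0 : 0 ≤ m := by
    have : t / |s| ≤ 1 := by rw [div_le_iff₀ h0]; linarith
    rw [hm']; linarith
  have h1 := hc.2 hp hm hl0 hm0 (by rw [hl, hm']; ring)
  have h2 := hc.2 hp hm hm0 hl0 (by rw [hl, hm']; ring)
  simp only [smul_eq_mul] at h1 h2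
  have e1 : l * (u + |s|) + m * (u - |s|) = u + t := by rw [hl, hm']; field_simp; ring
  have e2 : m * (u + |s|) + l * (u - |s|) = u - t := by rw [hl, hm']; field_simp; ring
  rw [e1] at h1
  rw [e2] at h2
  have e3 : l + m = 1 := by rw [hl, hm']; ring
  calc _ ≤ (l + m) * (u + |s|) ^ r + (l + m) * (u - |s|) ^ r := by linarith
    _ = _ := by rw [e3]; ring

/-- Clarkson's inequality for complex numbers: the Hausdorff–Young inequality on `ℤ/2`. -/
lemma clarkson_complex {p q : ℝ} (hpq : p.HolderConjugate q) (hq : 2 ≤ q) (x y : ℂ) :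
    ‖x + y‖ ^ q + ‖x - y‖ ^ q ≤ 2 * (‖x‖ ^ p + ‖y‖ ^ p) ^ (q / p) := by
  wlog h : ‖y‖ ≤ ‖x‖ generalizing x y
  · have := this y x (le_of_not_ge h)
    rwa [add_comm y x, norm_sub_rev y x, add_comm (‖y‖ ^ p)] at this
  refine le_trans ?_ (clarkson_real hpq hq (norm_nonneg y) h)
  have e : ∀ z : ℝ, 0 ≤ z → z ^ q = (z ^ 2) ^ (q / 2) := by
    intro z hz
    rw [← Real.rpow_natCast, ← Real.rpow_mul hz]
    congr 1; push_cast; ring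
  rw [e _ (norm_nonneg _), e _ (norm_nonneg (x - y)), e (‖x‖ + ‖y‖) (by positivity),
    e (‖x‖ - ‖y‖) (sub_nonneg.2 h)]
  -- The squared norms of `x ± y` are `u ± t`. Enlarging `|t|` to its Cauchy–Schwarz bound `2 * ‖x‖
  -- * ‖y‖` reduces the claim to nonnegative reals; `q ≥ 2` makes the exponent `q / 2` convex.
  have key := rpow_add_rpow_le_of_abs_le (u := ‖x‖ ^ 2 + ‖y‖ ^ 2) (s := 2 * (‖x‖ * ‖y‖))
    (t := 2 * (x * conj y).re) (r := q / 2) (by linarith) (by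
      rw [abs_of_nonneg (by positivity)]; nlinarith [sq_nonneg (‖x‖ - ‖y‖)]) (by
      rw [abs_mul, abs_mul (2 : ℝ)]
      refine mul_le_mul_of_nonneg_left ?_ (abs_nonneg _)
      refine (Complex.abs_re_le_norm _).trans ?_
      rw [norm_mul, RCLike.norm_conj]
      exact le_abs_self _)
  have f1 : ‖x + y‖ ^ 2 = ‖x‖ ^ 2 + ‖y‖ ^ 2 + 2 * (x * conj y).re := by
    simp only [← Complex.normSq_eq_norm_sq]; exact Complex.normSq_add x y
  have f2 : ‖x - y‖ ^ 2 = ‖x‖ ^ 2 + ‖y‖ ^ 2 - 2 * (x * conj y).re := by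
    simp only [← Complex.normSq_eq_norm_sq]; exact Complex.normSq_sub x y
  have f3 : (‖x‖ + ‖y‖) ^ 2 = ‖x‖ ^ 2 + ‖y‖ ^ 2 + 2 * (‖x‖ * ‖y‖) := by ring
  have f4 : (‖x‖ - ‖y‖) ^ 2 = ‖x‖ ^ 2 + ‖y‖ ^ 2 - 2 * (‖x‖ * ‖y‖) := by ring
  rwa [f1, f2, f3, f4, ← abs_of_nonneg (by positivity : 0 ≤ 2 * (‖x‖ * ‖y‖))]

/-- Minkowski's inequality in two-dimensional `ℓ^r` for the vectors `(a, b)` and `(0, c)`. -/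
lemma minkowski_pair {a b c r : ℝ} (ha : 0 ≤ a) (hb : 0 ≤ b) (hc : 0 ≤ c) (hr : 1 ≤ r) :
    a ^ r + (b + c) ^ r ≤ ((a ^ r + b ^ r) ^ (1 / r) + c) ^ r := by
  have hr0 : 0 < r := by linarith
  have h := Real.Lp_add_le Finset.univ ![a, b] ![0, c] hr
  simp only [Fin.sum_univ_two, Matrix.cons_val_zero, Matrix.cons_val_one, add_zero, abs_zero,
    Real.zero_rpow hr0.ne', zero_add, abs_of_nonneg ha, abs_of_nonneg hb, abs_of_nonneg hc,
    abs_of_nonneg (add_nonneg hb hc)] at h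
  rw [← Real.rpow_mul hc, mul_one_div_cancel hr0.ne', Real.rpow_one] at h
  have h2 := Real.rpow_le_rpow (by positivity) h hr0.le
  rwa [← Real.rpow_mul (by positivity), one_div_mul_cancel hr0.ne', Real.rpow_one] at h2

/-! ### The dyadic recursion

For a locally integrable `f`, put `s n = ∫_{U_n} f dω`. Then `s (n - 1)` and the Fourier coefficient
`F n` are the sum and the difference of `s n` and `2 ^ (-n) * f (n - 1)`: each level of the
hypergroup acts as a copy of `ℤ/2`. -/

/-- `s` and `F` arise from `f` by the recursion satisfied by the integrals over the subhypergroups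
`U_n` and by the Fourier coefficients. -/
structure DyadicRecursion (f s F : ℤ → ℂ) : Prop where
  add_eq : ∀ n, s (n - 1) = s n + (((2 : ℝ) ^ (-n) : ℝ) : ℂ) * f (n - 1)
  sub_eq : ∀ n, F n = s n - (((2 : ℝ) ^ (-n) : ℝ) : ℂ) * f (n - 1)

lemma minkowski_pair_ennreal (a b c : ℝ≥0∞) {r : ℝ} (hr : 1 ≤ r) :
    a ^ r + (b + c) ^ r ≤ ((a ^ r + b ^ r) ^ (1 / r) + c) ^ r := by
  have hr0 : 0 < r := by linarith
  have h := ENNReal.Lp_add_le Finset.univ ![a, b] ![0, c] hr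
  simp only [Fin.sum_univ_two, Matrix.cons_val_zero, Matrix.cons_val_one, add_zero,
    ENNReal.zero_rpow_of_pos hr0, zero_add] at h
  rw [← ENNReal.rpow_mul c, mul_one_div_cancel hr0.ne', ENNReal.rpow_one] at h
  have h2 := ENNReal.rpow_le_rpow h hr0.le
  rwa [← ENNReal.rpow_mul, one_div_mul_cancel hr0.ne', ENNReal.rpow_one] at h2

namespace DyadicRecursion

variable {f s F : ℤ → ℂ}

/-- The weights of the boundary terms are natural: `U_N` has mass `2 ^ (-N)`, so a constant on `U_N`
with integral `s N` contributes `2 ^ (N * (p - 1)) * ‖s N‖ ^ p`, and `2 ^ (N - L)` is the Plancherel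
mass of `{n ≤ N - L}`. -/
lemma hausdorffYoung (h : DyadicRecursion f s F) {p q : ℝ} (hpq : p.HolderConjugate q)
    (hq : 2 ≤ q) (N : ℤ) (L : ℕ) :
    ∑ j ∈ Finset.range L, (2 : ℝ) ^ (N - j - 1) * ‖F (N - j)‖ ^ q +
        (2 : ℝ) ^ (N - L) * ‖s (N - L)‖ ^ q ≤
      (∑ j ∈ Finset.range L, (2 : ℝ) ^ (-(N - j)) * ‖f (N - j - 1)‖ ^ p +
        (2 : ℝ) ^ (N * (p - 1)) * ‖s N‖ ^ p) ^ (q / p) := by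
  have hp := hpq.pos
  have hq0 := hpq.symm.pos
  have hmul := hpq.mul_eq_add
  have hlt := hpq.lt
  -- This is `(p - 1) * q = p`, which lets the two systems of weights match at every level.
  have hexp : ∀ n : ℤ, ((2 : ℝ) ^ (n * (p - 1))) ^ (q / p) = (2 : ℝ) ^ n := by
    intro n
    rw [← Real.rpow_mul two_pos.le, ← Real.rpow_intCast]
    congr 1
    field_simp
    linear_combination (n : ℝ) * hmul
  have hnorm : ∀ z : ℂ, (‖z‖ ^ p) ^ (q / p) = ‖z‖ ^ q := by
    intro z
    rw [← Real.rpow_mul (norm_nonneg _), mul_div_cancel₀ _ hp.ne']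
  have hr : 1 ≤ q / p := by
    rw [hpq.symm.div_conj_eq_sub_one]; linarith
  have hr0 : 0 < q / p := by linarith
  induction L with
  | zero =>
    simp only [Finset.range_zero, Finset.sum_empty, zero_add, Nat.cast_zero, sub_zero]
    rw [Real.mul_rpow (by positivity) (by positivity), hexp, hnorm]
  | succ L ih =>
    rw [Finset.sum_range_succ, Finset.sum_range_succ]
    set A := ∑ j ∈ Finset.range L, (2 : ℝ) ^ (N - j - 1) * ‖F (N - j)‖ ^ q with hA
    set B := ∑ j ∈ Finset.range L, (2 : ℝ) ^ (-(N - j)) * ‖f (N - j - 1)‖ ^ p +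
        (2 : ℝ) ^ (N * (p - 1)) * ‖s N‖ ^ p with hB
    have hA0 : 0 ≤ A := Finset.sum_nonneg fun _ _ => by positivity
    have hB0 : 0 ≤ B := add_nonneg (Finset.sum_nonneg fun _ _ => by positivity) (by positivity)
    rw [show N - ((L + 1 : ℕ) : ℤ) = N - L - 1 by push_cast; ring]
    set n : ℤ := N - L with hn
    set y : ℂ := (((2 : ℝ) ^ (-n) : ℝ) : ℂ) * f (n - 1) with hy
    have hc : (2 : ℝ) ^ (n * (p - 1)) * ‖y‖ ^ p = (2 : ℝ) ^ (-n) * ‖f (n - 1)‖ ^ p := by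
      rw [hy, norm_mul, Complex.norm_real, Real.norm_of_nonneg (by positivity),
        Real.mul_rpow (by positivity) (by positivity), ← mul_assoc]
      congr 1
      rw [← Real.rpow_intCast, ← Real.rpow_mul two_pos.le, ← Real.rpow_add two_pos]
      congr 1; push_cast; ring
    have key := clarkson_complex hpq hq (s n) y
    rw [← h.add_eq n, ← h.sub_eq n] at key
    have h2n : (2 : ℝ) ^ n = (2 : ℝ) ^ (n - 1) * 2 := by
      rw [zpow_sub_one₀ two_ne_zero]; ring
    -- The accumulated sum `A` is a spectator coordinate while Clarkson's inequality splits the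
    -- remaining term; Minkowski keeps the constant equal to one.
    have mink := minkowski_pair (a := A ^ (1 / (q / p)))
      (b := (2 : ℝ) ^ (n * (p - 1)) * ‖s n‖ ^ p) (c := (2 : ℝ) ^ (n * (p - 1)) * ‖y‖ ^ p)
      (by positivity) (by positivity) (by positivity) hr
    rw [← Real.rpow_mul hA0, one_div_mul_cancel hr0.ne', Real.rpow_one, ← mul_add,
      Real.mul_rpow (by positivity) (by positivity), hexp,
      Real.mul_rpow (by positivity) (by positivity), hexp, hnorm, hc] at mink
    have ih' : (A + (2 : ℝ) ^ n * ‖s n‖ ^ q) ^ (1 / (q / p)) ≤ B := by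
      have := Real.rpow_le_rpow (by positivity) ih (by positivity : 0 ≤ 1 / (q / p))
      rwa [← Real.rpow_mul hB0, mul_one_div_cancel hr0.ne', Real.rpow_one] at this
    calc A + (2 : ℝ) ^ (n - 1) * ‖F n‖ ^ q + (2 : ℝ) ^ (n - 1) * ‖s (n - 1)‖ ^ q
        = A + (2 : ℝ) ^ (n - 1) * (‖s (n - 1)‖ ^ q + ‖F n‖ ^ q) := by ring
      _ ≤ A + (2 : ℝ) ^ (n - 1) * (2 * (‖s n‖ ^ p + ‖y‖ ^ p) ^ (q / p)) := by gcongr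
      _ = A + (2 : ℝ) ^ n * (‖s n‖ ^ p + ‖y‖ ^ p) ^ (q / p) := by rw [h2n]; ring
      _ ≤ _ := mink
      _ ≤ (B + (2 : ℝ) ^ (-n) * ‖f (n - 1)‖ ^ p) ^ (q / p) := by gcongr
      _ = _ := by rw [hB]; congr 1; ring

/-- Together with `norm_sub_le` this is the endpoint `p = 1`, `q = ∞`, outside the range of
`hausdorffYoung`. -/
lemma norm_add_le (h : DyadicRecursion f s F) (N : ℤ) (L : ℕ) :
    ‖s (N - L)‖ ≤ ∑ j ∈ Finset.range L, (2 : ℝ) ^ (-(N - j)) * ‖f (N - j - 1)‖ + ‖s N‖ := by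
  induction L with
  | zero => simp
  | succ L ih =>
    rw [Finset.sum_range_succ, show N - ((L + 1 : ℕ) : ℤ) = N - L - 1 by push_cast; ring,
      h.add_eq]
    refine (_root_.norm_add_le _ _).trans ?_
    rw [norm_mul, Complex.norm_real, Real.norm_of_nonneg (by positivity)]
    linarith

lemma norm_sub_le (h : DyadicRecursion f s F) (N : ℤ) (L : ℕ) :
    ‖F (N - L)‖ ≤
      ∑ j ∈ Finset.range (L + 1), (2 : ℝ) ^ (-(N - j)) * ‖f (N - j - 1)‖ + ‖s N‖ := by
  rw [Finset.sum_range_succ, h.sub_eq]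
  refine (_root_.norm_sub_le _ _).trans ?_
  rw [norm_mul, Complex.norm_real, Real.norm_of_nonneg (by positivity)]
  linarith [h.norm_add_le N L]

/-- The parallelogram law replaces Clarkson's inequality. Being an equality, it can also be used to
bound `f` by `F`. -/
lemma parseval (h : DyadicRecursion f s F) (N : ℤ) (L : ℕ) :
    ∑ j ∈ Finset.range L, (2 : ℝ) ^ (N - j - 1) * ‖F (N - j)‖ ^ 2 +
        (2 : ℝ) ^ (N - L) * ‖s (N - L)‖ ^ 2 =
      ∑ j ∈ Finset.range L, (2 : ℝ) ^ (-(N - j)) * ‖f (N - j - 1)‖ ^ 2 +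
        (2 : ℝ) ^ N * ‖s N‖ ^ 2 := by
  induction L with
  | zero => simp
  | succ L ih =>
    rw [Finset.sum_range_succ, Finset.sum_range_succ,
      show N - ((L + 1 : ℕ) : ℤ) = N - L - 1 by push_cast; ring]
    set n : ℤ := N - L with hn
    set y : ℂ := (((2 : ℝ) ^ (-n) : ℝ) : ℂ) * f (n - 1) with hy
    have hc : (2 : ℝ) ^ n * ‖y‖ ^ 2 = (2 : ℝ) ^ (-n) * ‖f (n - 1)‖ ^ 2 := by
      rw [hy, norm_mul, Complex.norm_real, Real.norm_of_nonneg (by positivity), zpow_neg]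
      field_simp
    have key := parallelogram_law_with_norm ℝ (s n) y
    rw [← h.add_eq n, ← h.sub_eq n] at key
    have h2n : (2 : ℝ) ^ n = (2 : ℝ) ^ (n - 1) * 2 := by
      rw [zpow_sub_one₀ two_ne_zero]; ring
    rw [← hc]
    rw [h2n] at ih ⊢
    linear_combination ih + (2 : ℝ) ^ (n - 1) * key

end DyadicRecursion

/-! ### Integration against the Haar and Plancherel measures -/

lemma ae_haar_iff {P : H → Prop} : (∀ᵐ x ∂haar, P x) ↔ ∀ n : ℤ, P n := by
  rw [haar, Measure.ae_sum_iff]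
  refine forall_congr' fun n => ?_
  rw [Measure.ae_ennreal_smul_measure_iff (by simp; positivity), ae_dirac_eq]
  rfl

lemma ae_plancherel_iff {P : Hhat → Prop} : (∀ᵐ x ∂plancherel, P x) ↔ ∀ n : ℤ, P n := by
  rw [plancherel, Measure.ae_sum_iff]
  refine forall_congr' fun n => ?_
  rw [Measure.ae_ennreal_smul_measure_iff (by simp; positivity), ae_dirac_eq]
  rfl

lemma lintegral_haar (g : H → ℝ≥0∞) :
    ∫⁻ x, g x ∂haar = ∑' n : ℤ, ENNReal.ofReal ((2 : ℝ) ^ (-(n + 1))) * g n := by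
  rw [haar, lintegral_sum_measure]
  simp

lemma lintegral_plancherel (g : Hhat → ℝ≥0∞) :
    ∫⁻ x, g x ∂plancherel = ∑' n : ℤ, ENNReal.ofReal ((2 : ℝ) ^ (n - 1)) * g n := by
  rw [plancherel, lintegral_sum_measure]
  simp

lemma haar_singleton (n : ℤ) : haar {(n : H)} = ENNReal.ofReal ((2 : ℝ) ^ (-(n + 1))) := by
  rw [← lintegral_indicator_one (measurableSet_singleton _), lintegral_haar,
    tsum_eq_single n (by intro b hb; simp [hb])]
  simp

lemma plancherel_singleton (n : ℤ) :
    plancherel {(n : Hhat)} = ENNReal.ofReal ((2 : ℝ) ^ (n - 1)) := by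
  rw [← lintegral_indicator_one (measurableSet_singleton _), lintegral_plancherel,
    tsum_eq_single n (by intro b hb; simp [hb])]
  simp

lemma tsum_int_eq (u : ℤ → ℝ≥0∞) :
    ∑' n : ℤ, u n = ∑' k : ℕ, u k + ∑' k : ℕ, u (-(k + 1)) :=
  tsum_of_nat_of_neg_add_one ENNReal.summable ENNReal.summable

lemma tsum_int_eq_shift (u : ℤ → ℝ≥0∞) :
    ∑' n : ℤ, u n = ∑' k : ℕ, u (k + 1) + ∑' k : ℕ, u (-k) := by
  rw [← (Equiv.addRight (1 : ℤ)).tsum_eq u, tsum_int_eq]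
  simp

lemma setLIntegral_haar_Ici (g : H → ℝ≥0∞) :
    ∫⁻ x in Set.Ici 0, g x ∂haar =
      ∑' k : ℕ, ENNReal.ofReal ((2 : ℝ) ^ (-((k : ℤ) + 1))) * g (k : ℤ) := by
  rw [← lintegral_indicator (Set.to_countable _).measurableSet, lintegral_haar, tsum_int_eq]
  have h1 : ∀ k : ℕ, (((k : ℤ)) : H) ∈ Set.Ici (0 : H) := fun k =>
    WithTop.coe_le_coe.2 (Int.natCast_nonneg k)
  have h2 : ∀ k : ℕ, ((-((k : ℤ) + 1) : ℤ) : H) ∉ Set.Ici (0 : H) := fun k h => by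
    have := WithTop.coe_le_coe.1 h
    omega
  simp only [Set.indicator_of_mem (h1 _), Set.indicator_of_notMem (h2 _), mul_zero, tsum_zero,
    add_zero]

lemma setLIntegral_haar_compl (g : H → ℝ≥0∞) :
    ∫⁻ x in (Set.Ici 0)ᶜ, g x ∂haar =
      ∑' k : ℕ, ENNReal.ofReal ((2 : ℝ) ^ (k : ℤ)) * g (-((k : ℤ) + 1) : ℤ) := by
  rw [← lintegral_indicator (Set.to_countable _).measurableSet, lintegral_haar, tsum_int_eq]
  have h1 : ∀ k : ℕ, (((k : ℤ)) : H) ∉ (Set.Ici (0 : H))ᶜ := fun k h =>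
    h (WithTop.coe_le_coe.2 (Int.natCast_nonneg k))
  have h2 : ∀ k : ℕ, ((-((k : ℤ) + 1) : ℤ) : H) ∈ (Set.Ici (0 : H))ᶜ := fun k h => by
    have := WithTop.coe_le_coe.1 h
    omega
  simp only [Set.indicator_of_mem (h2 _), Set.indicator_of_notMem (h1 _), mul_zero, tsum_zero,
    zero_add]
  refine tsum_congr fun k => ?_
  congr 3; ring

lemma setLIntegral_plancherel_Iic (g : Hhat → ℝ≥0∞) :
    ∫⁻ x in Set.Iic 0, g x ∂plancherel =
      ∑' k : ℕ, ENNReal.ofReal ((2 : ℝ) ^ (-(k : ℤ) - 1)) * g (-(k : ℤ) : ℤ) := by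
  rw [← lintegral_indicator (Set.to_countable _).measurableSet, lintegral_plancherel,
    tsum_int_eq_shift]
  have h1 : ∀ k : ℕ, (((k : ℤ) + 1 : ℤ) : Hhat) ∉ Set.Iic (0 : Hhat) := fun k h => by
    have := WithBot.coe_le_coe.1 h
    omega
  have h2 : ∀ k : ℕ, ((-(k : ℤ) : ℤ) : Hhat) ∈ Set.Iic (0 : Hhat) := fun k =>
    WithBot.coe_le_coe.2 (by omega)
  simp only [Set.indicator_of_mem (h2 _), Set.indicator_of_notMem (h1 _), mul_zero, tsum_zero,
    zero_add]

lemma setLIntegral_plancherel_compl (g : Hhat → ℝ≥0∞) :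
    ∫⁻ x in (Set.Iic 0)ᶜ, g x ∂plancherel =
      ∑' k : ℕ, ENNReal.ofReal ((2 : ℝ) ^ (k : ℤ)) * g ((k : ℤ) + 1 : ℤ) := by
  rw [← lintegral_indicator (Set.to_countable _).measurableSet, lintegral_plancherel,
    tsum_int_eq_shift]
  have h1 : ∀ k : ℕ, (((k : ℤ) + 1 : ℤ) : Hhat) ∈ (Set.Iic (0 : Hhat))ᶜ := fun k h => by
    have := WithBot.coe_le_coe.1 h
    omega
  have h2 : ∀ k : ℕ, ((-(k : ℤ) : ℤ) : Hhat) ∉ (Set.Iic (0 : Hhat))ᶜ := fun k h =>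
    h (WithBot.coe_le_coe.2 (by omega))
  simp only [Set.indicator_of_mem (h1 _), Set.indicator_of_notMem (h2 _), mul_zero, tsum_zero,
    add_zero]
  refine tsum_congr fun k => ?_
  congr 3; ring

/-! ### Integrals over the subhypergroups and Fourier coefficients -/

lemma Ici_coe_sub_one (n : ℤ) :
    Set.Ici ((n - 1 : ℤ) : H) = insert ((n - 1 : ℤ) : H) (Set.Ici (n : H)) := by
  ext x
  induction x with
  | top => simp
  | coe k =>
    simp only [Set.mem_Ici, Set.mem_insert_iff, WithTop.coe_le_coe, WithTop.coe_inj]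
    omega

lemma Iic_coe_eq_insert (n : ℤ) :
    Set.Iic (n : Hhat) = insert (n : Hhat) (Set.Iic ((n - 1 : ℤ) : Hhat)) := by
  ext x
  induction x with
  | bot => simp
  | coe k =>
    simp only [Set.mem_Iic, Set.mem_insert_iff, WithBot.coe_le_coe, WithBot.coe_inj]
    omega

lemma sub_one_notMem_Ici (n : ℤ) : ((n - 1 : ℤ) : H) ∉ Set.Ici (n : H) := fun h => by
  have := WithTop.coe_le_coe.1 h
  omega

lemma notMem_Iic_sub_one (n : ℤ) : (n : Hhat) ∉ Set.Iic ((n - 1 : ℤ) : Hhat) := fun h => by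
  have := WithBot.coe_le_coe.1 h
  omega

lemma haar_singleton_lt_top (n : ℤ) : haar {(n : H)} < ∞ := by
  rw [haar_singleton]; exact ENNReal.ofReal_lt_top

/-- Different `U_n` differ by finitely many atoms of finite mass, so the level does not matter. -/
lemma integrableOn_Ici_of_integrableOn {E : Type*} [NormedAddCommGroup E] {f : H → E} {N : ℤ}
    (hf : IntegrableOn f (Set.Ici (N : H)) haar) (n : ℤ) : IntegrableOn f (Set.Ici (n : H)) haar := by
  rcases le_total N n with h | h
  · exact hf.mono_set (Set.Ici_subset_Ici.2 (WithTop.coe_le_coe.2 h))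
  · induction n, h using Int.leInductionDown with
    | base => exact hf
    | pred n _ ih =>
      rw [Ici_coe_sub_one, Set.insert_eq]
      exact (integrableOn_singleton (by simp) (haar_singleton_lt_top _)).union ih

lemma haar_Ici_zero : haar (Set.Ici 0) = 1 := by
  have h := setLIntegral_haar_Ici 1
  simp only [Pi.one_apply, mul_one, lintegral_const, one_mul, Measure.restrict_apply_univ] at h
  rw [h]
  have e : ∀ k : ℕ, ENNReal.ofReal ((2 : ℝ) ^ (-((k : ℤ) + 1))) = (2⁻¹ : ℝ≥0∞) ^ (k + 1) := by
    intro k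
    rw [zpow_neg, ← inv_zpow, show ((k : ℤ) + 1) = ((k + 1 : ℕ) : ℤ) by push_cast; ring,
      zpow_natCast, ENNReal.ofReal_pow (by positivity),
      ENNReal.ofReal_inv_of_pos two_pos, ENNReal.ofReal_ofNat]
  simp_rw [e]
  rw [ENNReal.tsum_geometric_add_one, ENNReal.one_sub_inv_two, inv_inv,
    ENNReal.inv_mul_cancel two_ne_zero ENNReal.ofNat_ne_top]

lemma haar_Ici_natCast (L : ℕ) :
    haar (Set.Ici (((L : ℤ)) : H)) = ENNReal.ofReal ((2 : ℝ) ^ (-(L : ℤ))) := by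
  induction L with
  | zero => simpa using haar_Ici_zero
  | succ L ih =>
    have h := Ici_coe_sub_one ((L : ℤ) + 1)
    rw [add_sub_cancel_right] at h
    have h2 := sub_one_notMem_Ici ((L : ℤ) + 1)
    rw [add_sub_cancel_right] at h2
    rw [h, Set.insert_eq, measure_union (Set.disjoint_singleton_left.2 h2)
      (Set.to_countable _).measurableSet, haar_singleton] at ih
    have e : ENNReal.ofReal ((2 : ℝ) ^ (-(L : ℤ))) =
        ENNReal.ofReal ((2 : ℝ) ^ (-((L : ℤ) + 1))) +
          ENNReal.ofReal ((2 : ℝ) ^ (-((L : ℤ) + 1))) := by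
      rw [← ENNReal.ofReal_add (by positivity) (by positivity), neg_add, ← sub_eq_add_neg,
        zpow_sub_one₀ two_ne_zero]
      congr 1; ring
    rw [e] at ih
    push_cast
    exact (ENNReal.add_right_inj ENNReal.ofReal_ne_top).1 ih

lemma integral_Ici_sub_one {f : H → ℂ} (hf : ∀ n : ℤ, IntegrableOn f (Set.Ici (n : H)) haar)
    (n : ℤ) : ∫ x in Set.Ici ((n - 1 : ℤ) : H), f x ∂haar =
      ∫ x in Set.Ici (n : H), f x ∂haar + (((2 : ℝ) ^ (-n) : ℝ) : ℂ) * f (n - 1 : ℤ) := by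
  rw [Ici_coe_sub_one, Set.insert_eq, setIntegral_union
    (Set.disjoint_singleton_left.2 (sub_one_notMem_Ici n)) (Set.to_countable _).measurableSet
    (integrableOn_singleton (by simp) (haar_singleton_lt_top _)) (hf n), integral_singleton,
    measureReal_def, haar_singleton, ENNReal.toReal_ofReal (by positivity), sub_add_cancel,
    add_comm, Complex.real_smul]

lemma conj_character (n : Hhat) (x : H) : conj (character n x) = character n x := by
  unfold character
  split
  · simp
  · split_ifs <;> simp

lemma character_coe (n : ℤ) (x : H) : character n x =
    if (n : H) ≤ x then 1 else if x = ((n - 1 : ℤ) : H) then -1 else 0 := rfl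

lemma fourierH_coe {f : H → ℂ} (hf : ∀ n : ℤ, IntegrableOn f (Set.Ici (n : H)) haar) (n : ℤ) :
    fourierH f n = ∫ x in Set.Ici (n : H), f x ∂haar -
      (((2 : ℝ) ^ (-n) : ℝ) : ℂ) * f (n - 1 : ℤ) := by
  have e : ∀ x, f x * conj (character n x) = (Set.Ici (n : H)).indicator f x -
      ({((n - 1 : ℤ) : H)} : Set H).indicator f x := by
    intro x
    rw [conj_character, character_coe]
    by_cases h1 : (n : H) ≤ x
    · have h2 : x ∉ ({((n - 1 : ℤ) : H)} : Set H) := by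
        rintro rfl
        exact sub_one_notMem_Ici n h1
      rw [if_pos h1, Set.indicator_of_mem (Set.mem_Ici.2 h1), Set.indicator_of_notMem h2]
      simp
    · rw [if_neg h1, Set.indicator_of_notMem (by simpa using h1)]
      by_cases h2 : x = ((n - 1 : ℤ) : H)
      · simp [h2]
      · rw [if_neg h2, Set.indicator_of_notMem (by simpa using h2)]
        simp
  have m : ∀ s : Set H, MeasurableSet s := fun s => (Set.to_countable s).measurableSet
  unfold fourierH
  simp_rw [e]
  rw [integral_sub ((hf n).integrable_indicator (m _))
    ((integrableOn_singleton (by simp) (haar_singleton_lt_top _)).integrable_indicator (m _)),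
    integral_indicator (m _), integral_indicator (m _), integral_singleton, measureReal_def,
    haar_singleton, ENNReal.toReal_ofReal (by positivity), sub_add_cancel, Complex.real_smul]

lemma dyadicRecursion_fourierH {f : H → ℂ}
    (hf : ∀ n : ℤ, IntegrableOn f (Set.Ici (n : H)) haar) :
    DyadicRecursion (fun n => f n) (fun n => ∫ x in Set.Ici (n : H), f x ∂haar)
      (fun n => fourierH f n) :=
  ⟨integral_Ici_sub_one hf, fourierH_coe hf⟩

/-! ### The Hausdorff–Young inequality on `U_0` and on the quotient by `U_0` -/

lemma ofReal_mul_norm_rpow {w q : ℝ} (hw : 0 ≤ w) (hq : 0 ≤ q) (z : ℂ) :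
    ENNReal.ofReal (w * ‖z‖ ^ q) = ENNReal.ofReal w * ‖z‖ₑ ^ q := by
  rw [ENNReal.ofReal_mul hw, ← ENNReal.ofReal_rpow_of_nonneg (norm_nonneg _) hq, ofReal_norm]

lemma sum_add_setLIntegral_Ici (g : H → ℝ≥0∞) (L : ℕ) :
    ∑ k ∈ Finset.range L, ENNReal.ofReal ((2 : ℝ) ^ (-((k : ℤ) + 1))) * g (k : ℤ) +
      ∫⁻ x in Set.Ici (((L : ℤ)) : H), g x ∂haar = ∫⁻ x in Set.Ici 0, g x ∂haar := by
  induction L with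
  | zero => simp
  | succ L ih =>
    have h := Ici_coe_sub_one ((L : ℤ) + 1)
    rw [add_sub_cancel_right] at h
    have h2 := sub_one_notMem_Ici ((L : ℤ) + 1)
    rw [add_sub_cancel_right] at h2
    rw [← ih, Finset.sum_range_succ, add_assoc, h, lintegral_insert h2, haar_singleton]
    push_cast
    rw [mul_comm (g _)]

/-- Hölder against `1` on `U_L`, of mass `2 ^ (-L)`. The weight is the one carried by `s L` in
`hausdorffYoung`, so the boundary term there is absorbed by the integral over `U_L`. -/
lemma enorm_setIntegral_Ici_rpow_le (f : H → ℂ) {p : ℝ} (hp : 1 < p) (L : ℕ) :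
    ENNReal.ofReal ((2 : ℝ) ^ (L * (p - 1))) * ‖∫ x in Set.Ici (((L : ℤ)) : H), f x ∂haar‖ₑ ^ p ≤
      ∫⁻ x in Set.Ici (((L : ℤ)) : H), ‖f x‖ₑ ^ p ∂haar := by
  have hp0 : 0 < p := by linarith
  have hpq := Real.HolderConjugate.conjExponent hp
  set q := p.conjExponent with hq
  have h := ENNReal.lintegral_mul_le_Lp_mul_Lq (haar.restrict (Set.Ici (((L : ℤ)) : H))) hpq
    (f := fun x => ‖f x‖ₑ) (g := 1) (Measurable.of_discrete.aemeasurable)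
    (Measurable.of_discrete.aemeasurable)
  simp only [mul_one, Pi.one_apply, ENNReal.one_rpow, lintegral_const, one_mul,
    Measure.restrict_apply_univ, haar_Ici_natCast] at h
  have h2 := ENNReal.rpow_le_rpow ((enorm_integral_le_lintegral_enorm f).trans h) hp0.le
  rw [ENNReal.mul_rpow_of_nonneg _ _ hp0.le, ← ENNReal.rpow_mul, one_div_mul_cancel hp0.ne',
    ENNReal.rpow_one, ← ENNReal.rpow_mul, ENNReal.ofReal_rpow_of_nonneg (by positivity)
      (mul_nonneg (one_div_nonneg.2 hpq.symm.pos.le) hp0.le),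
    ← Real.rpow_intCast, ← Real.rpow_mul two_pos.le] at h2
  have e : ((-(L : ℤ) : ℤ) : ℝ) * (1 / q * p) = -(L * (p - 1)) := by
    rw [one_div_mul_eq_div, hpq.div_conj_eq_sub_one]; push_cast; ring
  rw [e, Real.rpow_neg two_pos.le, ENNReal.ofReal_inv_of_pos (by positivity)] at h2
  refine (mul_le_mul_right h2 _).trans_eq ?_
  rw [mul_left_comm, ENNReal.mul_inv_cancel (by simp; positivity) ENNReal.ofReal_ne_top, mul_one]

lemma sum_range_sub_eq_sum_add_one (u : ℤ → ℝ) (L : ℕ) :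
    ∑ j ∈ Finset.range L, u (L - j) = ∑ j ∈ Finset.range L, u (j + 1) := by
  rw [← Finset.sum_range_reflect]
  refine Finset.sum_congr rfl fun j hj => ?_
  have := Finset.mem_range.1 hj
  congr 1
  omega

/-- The recursion runs from level `L` down to `0`, then `L` tends to infinity. The term with the
integral over `U_0` is kept on the left because the gluing with the discrete part consumes it. -/
lemma hausdorffYoung_compact {f : H → ℂ} (hf : ∀ n : ℤ, IntegrableOn f (Set.Ici (n : H)) haar)
    {p q : ℝ} (hpq : p.HolderConjugate q) (hq : 2 ≤ q) :
    ∫⁻ n in (Set.Iic 0)ᶜ, ‖fourierH f n‖ₑ ^ q ∂plancherel +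
        ‖∫ x in Set.Ici 0, f x ∂haar‖ₑ ^ q ≤
      (∫⁻ x in Set.Ici 0, ‖f x‖ₑ ^ p ∂haar) ^ (q / p) := by
  have hp := hpq.pos
  have hq0 := hpq.symm.pos
  rw [setLIntegral_plancherel_compl, ENNReal.tsum_eq_iSup_nat, ENNReal.iSup_add]
  refine iSup_le fun L => ?_
  have h := (dyadicRecursion_fourierH hf).hausdorffYoung hpq hq L L
  rw [sub_self, zpow_zero, one_mul] at h
  rw [sum_range_sub_eq_sum_add_one (fun m => (2 : ℝ) ^ (m - 1) * ‖fourierH f m‖ ^ q),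
    sum_range_sub_eq_sum_add_one (fun m => (2 : ℝ) ^ (-m) * ‖f (m - 1 : ℤ)‖ ^ p)] at h
  simp only [add_sub_cancel_right] at h
  have h' := ENNReal.ofReal_le_ofReal h
  rw [ENNReal.ofReal_add (Finset.sum_nonneg fun _ _ => by positivity) (by positivity),
    ENNReal.ofReal_sum_of_nonneg (fun _ _ => by positivity),
    ← ENNReal.ofReal_rpow_of_nonneg
      (add_nonneg (Finset.sum_nonneg fun _ _ => by positivity) (by positivity)) (by positivity),
    ENNReal.ofReal_add (Finset.sum_nonneg fun _ _ => by positivity) (by positivity),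
    ENNReal.ofReal_sum_of_nonneg (fun _ _ => by positivity),
    ofReal_mul_norm_rpow (by positivity) hp.le,
    Finset.sum_congr rfl (fun j _ => ofReal_mul_norm_rpow (by positivity) hq0.le _),
    Finset.sum_congr rfl (fun j _ => ofReal_mul_norm_rpow (by positivity) hp.le _),
    ← ENNReal.ofReal_rpow_of_nonneg (norm_nonneg _) hq0.le, ofReal_norm] at h'
  refine h'.trans (ENNReal.rpow_le_rpow ?_ (by positivity))
  rw [← sum_add_setLIntegral_Ici _ L]
  gcongr
  exact enorm_setIntegral_Ici_rpow_le f hpq.lt L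

/-- The recursion starts at level `0`; since `U_0` has mass one, its integral enters as one further
atom of unit weight. -/
lemma hausdorffYoung_discrete {f : H → ℂ} (hf : ∀ n : ℤ, IntegrableOn f (Set.Ici (n : H)) haar)
    {p q : ℝ} (hpq : p.HolderConjugate q) (hq : 2 ≤ q) :
    ∫⁻ n in Set.Iic 0, ‖fourierH f n‖ₑ ^ q ∂plancherel ≤
      (∫⁻ x in (Set.Ici 0)ᶜ, ‖f x‖ₑ ^ p ∂haar +
        ‖∫ x in Set.Ici 0, f x ∂haar‖ₑ ^ p) ^ (q / p) := by
  have hp := hpq.pos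
  have hq0 := hpq.symm.pos
  rw [setLIntegral_plancherel_Iic, setLIntegral_haar_compl]
  refine ENNReal.tsum_le_of_sum_range_le fun L => ?_
  have h := (le_add_of_nonneg_right (by positivity)).trans
    ((dyadicRecursion_fourierH hf).hausdorffYoung hpq hq 0 L)
  simp only [zero_sub, Int.cast_zero, zero_mul, Real.rpow_zero, one_mul, neg_neg,
    ← neg_add'] at h
  have h' := ENNReal.ofReal_le_ofReal h
  rw [ENNReal.ofReal_sum_of_nonneg (fun _ _ => by positivity),
    ← ENNReal.ofReal_rpow_of_nonneg
      (add_nonneg (Finset.sum_nonneg fun _ _ => by positivity) (by positivity)) (by positivity),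
    ENNReal.ofReal_add (Finset.sum_nonneg fun _ _ => by positivity) (by positivity),
    ENNReal.ofReal_sum_of_nonneg (fun _ _ => by positivity),
    Finset.sum_congr rfl (fun j _ => ofReal_mul_norm_rpow (by positivity) hq0.le _),
    Finset.sum_congr rfl (fun j _ => ofReal_mul_norm_rpow (by positivity) hp.le _),
    ← ENNReal.ofReal_rpow_of_nonneg (norm_nonneg _) hp.le, ofReal_norm] at h'
  simp only [← neg_add']
  refine h'.trans (ENNReal.rpow_le_rpow ?_ (by positivity))
  gcongr
  · exact ENNReal.sum_le_tsum _
  · exact le_rfl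

/-- For `n > 0` the support `U_(n-1)` of `χ_n` lies in `U_0`. -/
lemma enorm_fourierH_le (f : H → ℂ) {n : ℤ} (hn : 0 < n) :
    ‖fourierH f n‖ₑ ≤ ∫⁻ x in Set.Ici 0, ‖f x‖ₑ ∂haar := by
  refine (enorm_integral_le_lintegral_enorm _).trans ?_
  rw [← lintegral_indicator (Set.to_countable _).measurableSet]
  refine lintegral_mono fun x => ?_
  rw [conj_character, character_coe, enorm_mul]
  by_cases hx : x ∈ Set.Ici (0 : H)
  · rw [Set.indicator_of_mem hx]
    split_ifs <;> simp
  · rw [Set.indicator_of_notMem hx, if_neg, if_neg]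
    · simp
    · rintro rfl
      exact hx (WithTop.coe_le_coe.2 (by omega))
    · exact fun h => hx (le_trans (WithTop.coe_le_coe.2 hn.le) h)

lemma enorm_fourierH_le_of_nonpos {f : H → ℂ}
    (hf : ∀ n : ℤ, IntegrableOn f (Set.Ici (n : H)) haar) {n : ℤ} (hn : n ≤ 0) :
    ‖fourierH f n‖ₑ ≤
      ∫⁻ x in (Set.Ici 0)ᶜ, ‖f x‖ₑ ∂haar + ‖∫ x in Set.Ici 0, f x ∂haar‖ₑ := by
  obtain ⟨L, rfl⟩ : ∃ L : ℕ, n = 0 - L := ⟨(-n).toNat, by omega⟩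
  have h := (dyadicRecursion_fourierH hf).norm_sub_le 0 L
  have h' := ENNReal.ofReal_le_ofReal h
  rw [ENNReal.ofReal_add (Finset.sum_nonneg fun _ _ => by positivity) (by positivity),
    ENNReal.ofReal_sum_of_nonneg (fun _ _ => by positivity), ofReal_norm, ofReal_norm] at h'
  refine h'.trans ?_
  rw [setLIntegral_haar_compl]
  refine add_le_add ?_ le_rfl
  refine le_trans (Finset.sum_le_sum fun j _ => ?_) (ENNReal.sum_le_tsum (Finset.range (L + 1)))
  rw [ENNReal.ofReal_mul (by positivity), ofReal_norm, zero_sub, neg_neg, ← neg_add']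

/-! ### The Hausdorff–Young theorem for the amalgam norms -/

lemma two_le_toReal_of_holderConjugate {p q : ℝ≥0∞} (hpq : p.HolderConjugate q) (hp : p ≤ 2)
    (hq : q ≠ ∞) : 2 ≤ q.toReal := by
  have h := ENNReal.HolderConjugate.inv_add_inv_eq_one p q
  have h2 : (2 : ℝ≥0∞)⁻¹ ≤ p⁻¹ := ENNReal.inv_le_inv.2 hp
  have h3 : 2⁻¹ + q⁻¹ ≤ 2⁻¹ + 2⁻¹ := by
    rw [ENNReal.inv_two_add_inv_two, ← h]
    gcongr
  have h4 : (2 : ℝ≥0∞) ≤ q :=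
    ENNReal.inv_le_inv.1 ((ENNReal.add_le_add_iff_left (by simp)).1 h3)
  simpa using ENNReal.toReal_mono hq h4

lemma eLpNorm_rpow_toReal {X : Type*} [MeasurableSpace X] (μ : Measure X) (f : X → ℂ) {p : ℝ≥0∞}
    (h0 : p ≠ 0) (ht : p ≠ ∞) :
    eLpNorm f p μ ^ p.toReal = ∫⁻ x, ‖f x‖ₑ ^ p.toReal ∂μ := by
  rw [eLpNorm_eq_lintegral_rpow_enorm_toReal h0 ht, ← ENNReal.rpow_mul,
    one_div_mul_cancel (ENNReal.toReal_pos h0 ht).ne', ENNReal.rpow_one]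

lemma ae_restrict_haar {s : Set H} {P : H → Prop} (h : ∀ n : ℤ, (n : H) ∈ s → P n) :
    ∀ᵐ x ∂haar.restrict s, P x :=
  (ae_restrict_iff' (Set.to_countable _).measurableSet).2 (ae_haar_iff.2 h)

lemma ae_restrict_plancherel {s : Set Hhat} {P : Hhat → Prop}
    (h : ∀ n : ℤ, (n : Hhat) ∈ s → P n) : ∀ᵐ x ∂plancherel.restrict s, P x :=
  (ae_restrict_iff' (Set.to_countable _).measurableSet).2 (ae_plancherel_iff.2 h)

section

variable {f : H → ℂ} (hf : ∀ n : ℤ, IntegrableOn f (Set.Ici (n : H)) haar)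

include hf

lemma eLpNorm_fourierH_compl_rpow_add_le {p q : ℝ≥0∞} (hpq : p.HolderConjugate q) (hp : p ≤ 2)
    (hq : q ≠ ∞) :
    eLpNorm (fourierH f) q (plancherel.restrict (Set.Iic 0)ᶜ) ^ q.toReal +
        ‖∫ x in Set.Ici 0, f x ∂haar‖ₑ ^ q.toReal ≤
      eLpNorm f p (haar.restrict (Set.Ici 0)) ^ q.toReal := by
  have hp0 := ENNReal.HolderConjugate.ne_zero p q
  have hq0 := ENNReal.HolderConjugate.ne_zero q p
  have hpt : p ≠ ∞ := (hp.trans_lt ENNReal.ofNat_lt_top).ne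
  rw [eLpNorm_rpow_toReal _ _ hq0 hq, eLpNorm_eq_lintegral_rpow_enorm_toReal hp0 hpt,
    ← ENNReal.rpow_mul, one_div_mul_eq_div]
  exact hausdorffYoung_compact hf (ENNReal.HolderConjugate.toReal_of_ne_top hpt hq)
    (two_le_toReal_of_holderConjugate hpq hp hq)

lemma eLpNorm_fourierH_Iic_le {p q : ℝ≥0∞} (hpq : p.HolderConjugate q) (hp : p ≤ 2) :
    eLpNorm (fourierH f) q (plancherel.restrict (Set.Iic 0)) ≤
      (eLpNorm f p (haar.restrict (Set.Ici 0)ᶜ) ^ p.toReal +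
        ‖∫ x in Set.Ici 0, f x ∂haar‖ₑ ^ p.toReal) ^ (1 / p.toReal) := by
  have hp0 := ENNReal.HolderConjugate.ne_zero p q
  have hq0 := ENNReal.HolderConjugate.ne_zero q p
  have hpt : p ≠ ∞ := (hp.trans_lt ENNReal.ofNat_lt_top).ne
  rw [eLpNorm_rpow_toReal _ _ hp0 hpt]
  by_cases hq : q = ∞
  · obtain rfl : p = 1 := (ENNReal.HolderConjugate.eq_top_iff_eq_one q p).1 hq
    rw [hq, eLpNorm_exponent_top]
    refine eLpNormEssSup_le_of_ae_enorm_bound (ae_restrict_plancherel fun n hn => ?_)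
    simpa using enorm_fourierH_le_of_nonpos hf (WithBot.coe_le_coe.1 hn)
  · rw [eLpNorm_eq_lintegral_rpow_enorm_toReal hq0 hq]
    have hqr := (ENNReal.toReal_pos hq0 hq)
    have h := hausdorffYoung_discrete hf (ENNReal.HolderConjugate.toReal_of_ne_top hpt hq)
      (two_le_toReal_of_holderConjugate hpq hp hq)
    refine (ENNReal.rpow_le_rpow h (by positivity)).trans_eq ?_
    rw [← ENNReal.rpow_mul]
    congr 1
    field_simp

end

theorem normHhat_fourierH_le {p q p' q' : ℝ≥0∞} (hp2 : p ≤ 2) (hq2 : q ≤ 2)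
    (hpp : p.HolderConjugate p') (hqq : q.HolderConjugate q') (f : H → ℂ) :
    normHhat q' p' (fourierH f) ≤ normH p q f := by
  have hp0 := ENNReal.HolderConjugate.ne_zero p p'
  have hp1 := ENNReal.HolderConjugate.one_le p p'
  have hpt : p ≠ ∞ := (hp2.trans_lt ENNReal.ofNat_lt_top).ne
  have hq0 := ENNReal.HolderConjugate.ne_zero q q'
  have hqt : q ≠ ∞ := (hq2.trans_lt ENNReal.ofNat_lt_top).ne
  have hqr := ENNReal.toReal_pos hq0 hqt
  rw [normH, amalgamNorm, if_neg hqt]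
  set G := eLpNorm f q (haar.restrict (Set.Ici 0)ᶜ)
  set B := eLpNorm f p (haar.restrict (Set.Ici 0)) with hB
  -- Finiteness of `B` is what makes `f` integrable on `U_0`, as the recursion requires; if `B` is
  -- infinite there is nothing to prove.
  by_cases hBt : B = ∞
  · rw [hBt, ENNReal.top_rpow_of_pos hqr, add_top, ENNReal.top_rpow_of_pos (by positivity)]
    exact le_top
  have hf0 : IntegrableOn f (Set.Ici ((0 : ℤ) : H)) haar := by
    have : IsFiniteMeasure (haar.restrict (Set.Ici (0 : H))) :=
      ⟨by rw [Measure.restrict_apply_univ, haar_Ici_zero]; exact ENNReal.one_lt_top⟩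
    exact MemLp.integrable (q := p) hp1
      ⟨(Measurable.of_discrete).aestronglyMeasurable, lt_top_iff_ne_top.2 hBt⟩
  have hf := integrableOn_Ici_of_integrableOn hf0
  have hD := eLpNorm_fourierH_Iic_le hf hqq hq2
  rw [normHhat, amalgamNorm]
  set D := eLpNorm (fourierH f) q' (plancherel.restrict (Set.Iic 0))
  set a := ‖∫ x in Set.Ici 0, f x ∂haar‖ₑ with ha
  split_ifs with hp't
  · obtain rfl : p = 1 := (ENNReal.HolderConjugate.eq_top_iff_eq_one p' p).1 hp't
    have hB1 : B = ∫⁻ x in Set.Ici 0, ‖f x‖ₑ ∂haar := eLpNorm_one_eq_lintegral_enorm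
    have haB : a ≤ B := hB1 ▸ enorm_integral_le_lintegral_enorm _
    refine max_le ?_ (hD.trans ?_)
    · refine le_trans (b := B) ?_ ?_
      · rw [eLpNorm_exponent_top, hB1]
        refine eLpNormEssSup_le_of_ae_enorm_bound (ae_restrict_plancherel fun n hn => ?_)
        exact enorm_fourierH_le f (not_le.1 fun h => hn (WithBot.coe_le_coe.2 h))
      · calc B = (B ^ q.toReal) ^ (1 / q.toReal) := by
              rw [← ENNReal.rpow_mul, mul_one_div_cancel hqr.ne', ENNReal.rpow_one]
          _ ≤ _ := ENNReal.rpow_le_rpow le_add_self (by positivity)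
    · gcongr
  · have hA := eLpNorm_fourierH_compl_rpow_add_le hf hpp hp2 hp't
    have hp'0 := ENNReal.HolderConjugate.ne_zero p' p
    have hp'r := ENNReal.toReal_pos hp'0 hp't
    set A := eLpNorm (fourierH f) p' (plancherel.restrict (Set.Iic 0)ᶜ)
    have hr : 1 ≤ p'.toReal / q.toReal := by
      rw [le_div_iff₀ hqr, one_mul]
      have h1 := two_le_toReal_of_holderConjugate hpp hp2 hp't
      have h2 : q.toReal ≤ 2 := by simpa using ENNReal.toReal_mono ENNReal.ofNat_ne_top hq2
      linarith
    have e : ∀ x : ℝ≥0∞, x ^ p'.toReal = (x ^ q.toReal) ^ (p'.toReal / q.toReal) := by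
      intro x
      rw [← ENNReal.rpow_mul, mul_div_cancel₀ _ hqr.ne']
    -- Minkowski with exponent `p' / q ≥ 1` moves `a` from the company of `G` to that of `A`, where
    -- the compact estimate bounds `A` and `a` jointly by `B`.
    have key : A ^ p'.toReal + D ^ p'.toReal ≤
        (G ^ q.toReal + B ^ q.toReal) ^ (p'.toReal / q.toReal) := by
      calc A ^ p'.toReal + D ^ p'.toReal
          ≤ A ^ p'.toReal + ((G ^ q.toReal + a ^ q.toReal) ^ (1 / q.toReal)) ^ p'.toReal := by
            gcongr
        _ = (A ^ q.toReal) ^ (p'.toReal / q.toReal) +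
            (a ^ q.toReal + G ^ q.toReal) ^ (p'.toReal / q.toReal) := by
            rw [← e, ← ENNReal.rpow_mul, one_div_mul_eq_div, add_comm (G ^ _)]
        _ ≤ _ := minkowski_pair_ennreal _ _ _ hr
        _ ≤ _ := by
            rw [← e, ← e, add_comm (G ^ _)]
            gcongr
            refine (ENNReal.rpow_le_rpow hA (by positivity)).trans_eq ?_
            rw [e B, ← ENNReal.rpow_mul, mul_one_div_cancel (by positivity), ENNReal.rpow_one]
    refine (ENNReal.rpow_le_rpow key (by positivity)).trans_eq ?_
    rw [← ENNReal.rpow_mul]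
    congr 1
    field_simp

/-! ### The topology of `H` -/

lemma exists_Ici_subset_of_mem_nhds_top {U : Set H} (hU : U ∈ 𝓝 (⊤ : H)) :
    ∃ N : ℤ, Set.Ici (N : H) ⊆ U := by
  obtain ⟨l, hl, hlU⟩ := exists_Ioc_subset_of_mem_nhds hU ⟨((0 : ℤ) : H), WithTop.coe_lt_top 0⟩
  lift l to ℤ using hl.ne
  refine ⟨l + 1, fun x hx => hlU ⟨lt_of_lt_of_le (WithTop.coe_lt_coe.2 (lt_add_one l)) hx, le_top⟩⟩

lemma continuous_of_eq_of_le {g : H → ℂ} {N : ℤ} (hg : ∀ x, (N : H) ≤ x → g x = g ⊤) :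
    Continuous g := by
  rw [continuous_iff_continuousAt]
  intro x
  induction x using WithTop.recTopCoe with
  | top =>
    refine tendsto_const_nhds.congr' ?_
    filter_upwards [Ici_mem_nhds (WithTop.coe_lt_top N)] with x hx using (hg x hx).symm
  | coe n =>
    rw [ContinuousAt, WithTop.nhds_coe, nhds_discrete, map_pure]
    exact tendsto_pure_nhds g _

lemma hasCompactSupport_of_eq_zero {g : H → ℂ} {N : ℤ} (hg : ∀ x, ¬ (N : H) ≤ x → g x = 0) :
    HasCompactSupport g :=
  HasCompactSupport.intro (isCompact_Icc (a := (N : H)) (b := ⊤))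
    fun x hx => hg x fun h => hx ⟨h, le_top⟩

lemma haar_Ici_lt_top (n : ℤ) : haar (Set.Ici (n : H)) < ∞ := by
  have h : IntegrableOn (fun _ : H => (1 : ℝ)) (Set.Ici ((0 : ℤ) : H)) haar := by
    refine integrableOn_const ?_
    rw [WithTop.coe_zero, haar_Ici_zero]
    exact ENNReal.one_ne_top
  have h2 := integrableOn_Ici_of_integrableOn h n
  simpa [integrableOn_const_iff] using h2

/-! ### Positivity of the Fourier coefficients of functions of positive type -/

lemma selfConv_coe (n : ℤ) : selfConv (n : H) = Measure.sum fun k : ℕ =>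
    ENNReal.ofReal ((1 / 2 : ℝ) ^ (k + 1)) • Measure.dirac ((n + (k + 1) : ℤ) : H) := rfl

/-- `ε_n * ε_n` is a probability measure carried by the points strictly above `n`. -/
lemma integral_selfConv_coe_eq_one {g : H → ℂ} {n : ℤ} (hg : ∀ y, (n : H) < y → g y = 1) :
    ∫ z, g z ∂(selfConv n) = 1 := by
  have hae : ∀ᵐ z ∂(selfConv n), g z = 1 := by
    rw [selfConv_coe, Measure.ae_sum_iff]
    intro k
    rw [Measure.ae_ennreal_smul_measure_iff (by simp), ae_dirac_eq]
    exact hg _ (WithTop.coe_lt_coe.2 (by omega))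
  have hmass : selfConv (n : H) Set.univ = 1 := by
    rw [selfConv_coe, Measure.sum_apply _ MeasurableSet.univ]
    have e : ∀ k : ℕ, ENNReal.ofReal ((1 / 2 : ℝ) ^ (k + 1)) = (2⁻¹ : ℝ≥0∞) ^ (k + 1) := by
      intro k
      rw [ENNReal.ofReal_pow (by positivity), one_div, ENNReal.ofReal_inv_of_pos two_pos,
        ENNReal.ofReal_ofNat]
    simp only [Measure.smul_apply, measure_univ, smul_eq_mul, mul_one, e]
    rw [ENNReal.tsum_geometric_add_one, ENNReal.one_sub_inv_two, inv_inv,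
      ENNReal.inv_mul_cancel two_ne_zero ENNReal.ofNat_ne_top]
  rw [integral_congr_ae hae]
  simp [measureReal_def, hmass]

/-- A function `g` with values in `{-1, 0, 1}` such that `g = 1` above every point where `g` does
not vanish. -/
structure IsStepFunction (g : H → ℂ) : Prop where
  sq_eq_one : ∀ x, g x ≠ 0 → g x ^ 2 = 1
  eq_one_of_lt : ∀ x y, x < y → g x ≠ 0 → g y = 1
  conj_eq : ∀ x, conj (g x) = g x
  eq_zero : ∃ N : ℤ, ∀ x, ¬ (N : H) ≤ x → g x = 0
  eq_one : ∃ N : ℤ, ∀ x, (N : H) ≤ x → g x = 1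

namespace IsStepFunction

variable {g : H → ℂ} (hg : IsStepFunction g)

include hg

/-- Where `g y ≠ 0`, `g` equals `1` above `y`, so translation by `y` only multiplies `g` by `g y`.
On the diagonal this holds because `ε_n * ε_n` lives above `n`. -/
lemma integral_pointConv_mul (x y : H) :
    (∫ z, g z ∂(pointConv x y)) * g y = g x * g y ^ 2 := by
  by_cases hy : g y = 0
  · simp [hy]
  have hy2 := hg.sq_eq_one y hy
  unfold pointConv
  split_ifs with hxy
  · subst hxy
    induction x using WithTop.recTopCoe with
    | top =>
      change (∫ z, g z ∂(Measure.dirac (⊤ : H))) * g ⊤ = g ⊤ * g ⊤ ^ 2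
      obtain ⟨N, hN⟩ := hg.eq_one
      rw [integral_dirac, hN ⊤ le_top]
      ring
    | coe n =>
      rw [integral_selfConv_coe_eq_one fun z hz => hg.eq_one_of_lt _ z hz hy, hy2]
      ring
  · rw [integral_dirac, hy2, mul_one]
    rcases lt_or_gt_of_ne hxy with h | h
    · rw [min_eq_left h.le]
      by_cases hx : g x = 0
      · simp [hx]
      · rw [hg.eq_one_of_lt x y h hx, mul_one]
    · rw [min_eq_right h.le, hg.eq_one_of_lt y x h hy, ← sq, hy2]

lemma funConv_conj (x : H) : funConv g (fun y => conj (g y)) x =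
    g x * (haar.real (Function.support g) : ℂ) := by
  unfold funConv
  have e : ∀ y, (∫ z, g z ∂(pointConv x y)) * conj (g y) =
      g x * (Function.support g).indicator 1 y := by
    intro y
    rw [hg.conj_eq, hg.integral_pointConv_mul]
    by_cases hy : g y = 0
    · simp [hy]
    · rw [hg.sq_eq_one y hy, Set.indicator_of_mem (by simpa using hy), Pi.one_apply]
  simp_rw [e]
  rw [integral_const_mul, integral_indicator (Set.to_countable _).measurableSet]
  simp

lemma haarReal_support_pos : 0 < haar.real (Function.support g) := by
  obtain ⟨N, hN⟩ := hg.eq_zero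
  obtain ⟨M, hM⟩ := hg.eq_one
  refine ENNReal.toReal_pos (fun h => ?_) (ne_top_of_le_ne_top (haar_Ici_lt_top N).ne
    (measure_mono fun x hx => by_contra fun h => hx (hN x h)))
  have h2 : haar {(M : H)} = 0 := measure_mono_null (by
    rintro _ rfl
    simp [hM M le_rfl]) h
  rw [haar_singleton, ENNReal.ofReal_eq_zero] at h2
  exact absurd h2 (not_le.2 (by positivity))

lemma continuous : Continuous g := by
  obtain ⟨N, hN⟩ := hg.eq_one
  exact continuous_of_eq_of_le (N := N) fun x hx => by rw [hN x hx, hN ⊤ le_top]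

lemma hasCompactSupport : HasCompactSupport g := by
  obtain ⟨N, hN⟩ := hg.eq_zero
  exact hasCompactSupport_of_eq_zero hN

/-- By `funConv_conj`, `g * g^*` is a positive multiple of `g`, so testing positivity on `g` gives
the sign of the integral of `f * g`. -/
lemma integral_mul_nonneg {f : H → ℂ} (hf : IsPositiveType f) : 0 ≤ ∫ x, f x * g x ∂haar := by
  have h := hf.integral_nonneg g hg.continuous hg.hasCompactSupport
  simp_rw [hg.funConv_conj, ← mul_assoc] at h
  rw [integral_mul_const] at h
  have hC := hg.haarReal_support_pos
  set C := haar.real (Function.support g)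
  have h2 : (0 : ℂ) ≤ ((C⁻¹ : ℝ) : ℂ) := Complex.zero_le_real.2 (inv_nonneg.2 hC.le)
  have h3 := mul_nonneg h h2
  rwa [mul_assoc, ← Complex.ofReal_mul, mul_inv_cancel₀ hC.ne', Complex.ofReal_one, mul_one] at h3

end IsStepFunction

lemma isStepFunction_indicator_Ici (n : ℤ) :
    IsStepFunction ((Set.Ici (n : H)).indicator 1) where
  sq_eq_one x hx := by
    have : x ∈ Set.Ici (n : H) := Set.mem_of_indicator_ne_zero hx
    rw [Set.indicator_of_mem this]; simp
  eq_one_of_lt x y hxy hx := by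
    have : x ∈ Set.Ici (n : H) := Set.mem_of_indicator_ne_zero hx
    rw [Set.indicator_of_mem (Set.mem_Ici.2 (le_trans this hxy.le))]; rfl
  conj_eq x := by
    by_cases h : x ∈ Set.Ici (n : H)
    · simp [Set.indicator_of_mem h]
    · simp [Set.indicator_of_notMem h]
  eq_zero := ⟨n, fun x hx => Set.indicator_of_notMem (s := Set.Ici (n : H)) hx _⟩
  eq_one := ⟨n, fun _ hx => Set.indicator_of_mem (Set.mem_Ici.2 hx) _⟩

lemma coe_le_of_coe_sub_one_lt {n : ℤ} {y : H} (h : ((n - 1 : ℤ) : H) < y) : (n : H) ≤ y := by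
  induction y using WithTop.recTopCoe with
  | top => exact le_top
  | coe k =>
    have := WithTop.coe_lt_coe.1 h
    exact WithTop.coe_le_coe.2 (by omega)

lemma isStepFunction_character (n : ℤ) : IsStepFunction (character n) where
  sq_eq_one x := by
    rw [character_coe]
    split_ifs <;> simp
  eq_one_of_lt x y hxy hx := by
    rw [character_coe] at hx ⊢
    rw [if_pos]
    split_ifs at hx with h1 h2
    · exact h1.trans hxy.le
    · exact coe_le_of_coe_sub_one_lt (h2 ▸ hxy)
    · exact absurd rfl hx
  conj_eq := conj_character n
  eq_zero := ⟨n - 1, fun x hx => by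
    rw [character_coe, if_neg, if_neg]
    · rintro rfl; exact hx le_rfl
    · exact fun h => hx (le_trans (WithTop.coe_le_coe.2 (by omega)) h)⟩
  eq_one := ⟨n, fun x hx => by rw [character_coe, if_pos hx]⟩

namespace IsPositiveType

variable {f : H → ℂ} (hf : IsPositiveType f)

include hf

lemma integrableOn_Ici (n : ℤ) : IntegrableOn f (Set.Ici (n : H)) haar := by
  obtain ⟨U, hU, hfU⟩ := hf.locallyIntegrable ⊤
  obtain ⟨N, hN⟩ := exists_Ici_subset_of_mem_nhds_top hU
  exact integrableOn_Ici_of_integrableOn (hfU.mono_set hN) n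

lemma setIntegral_Ici_nonneg (n : ℤ) : 0 ≤ ∫ x in Set.Ici (n : H), f x ∂haar := by
  have h := (isStepFunction_indicator_Ici n).integral_mul_nonneg hf
  rw [← integral_indicator (Set.to_countable _).measurableSet]
  convert h using 3 with x
  by_cases hx : x ∈ Set.Ici (n : H)
  · simp [Set.indicator_of_mem hx]
  · simp [Set.indicator_of_notMem hx]

lemma fourierH_nonneg (n : ℤ) : 0 ≤ fourierH f n := by
  unfold fourierH
  simp_rw [conj_character]
  exact (isStepFunction_character n).integral_mul_nonneg hf

end IsPositiveType

/-! ### The inverse Fourier transform -/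

lemma plancherel_singleton_lt_top (n : ℤ) : plancherel {(n : Hhat)} < ∞ := by
  rw [plancherel_singleton]; exact ENNReal.ofReal_lt_top

lemma integrableOn_Iic_of_integrableOn {φ : Hhat → ℂ} {N : ℤ}
    (hφ : IntegrableOn φ (Set.Iic (N : Hhat)) plancherel) (n : ℤ) :
    IntegrableOn φ (Set.Iic (n : Hhat)) plancherel := by
  rcases le_total n N with h | h
  · exact hφ.mono_set (Set.Iic_subset_Iic.2 (WithBot.coe_le_coe.2 h))
  · induction n, h using Int.leInduction with
    | base => exact hφ
    | succ n _ ih =>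
      rw [Iic_coe_eq_insert, Set.insert_eq, add_sub_cancel_right]
      exact (integrableOn_singleton (by simp) (plancherel_singleton_lt_top _)).union ih

lemma plancherel_bot : plancherel {(⊥ : Hhat)} = 0 := by
  rw [← lintegral_indicator_one (measurableSet_singleton _), lintegral_plancherel]
  simp

/-- As a function of its index, a character at the integer `n` is `1` up to `n`, `-1` at `n + 1` and
`0` beyond: the mirror image of its behaviour on `H`. -/
lemma mul_character_eq (φ : Hhat → ℂ) (n : ℤ) (m : Hhat) : φ m * character m n =
    (Set.Iic (n : Hhat)).indicator φ m - ({((n + 1 : ℤ) : Hhat)} : Set Hhat).indicator φ m := by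
  induction m using WithBot.recBotCoe with
  | bot =>
    have h : (⊥ : Hhat) ∉ ({((n + 1 : ℤ) : Hhat)} : Set Hhat) :=
      fun h => WithBot.bot_ne_coe (Set.mem_singleton_iff.1 h)
    rw [Set.indicator_of_mem (Set.mem_Iic.2 bot_le), Set.indicator_of_notMem h, sub_zero]
    exact mul_one _
  | coe k =>
    rw [character_coe]
    by_cases h1 : k ≤ n
    · have h2 : (k : Hhat) ∉ ({((n + 1 : ℤ) : Hhat)} : Set Hhat) := fun h => by
        have := WithBot.coe_injective (Set.mem_singleton_iff.1 h)
        omega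
      rw [if_pos (WithTop.coe_le_coe.2 h1), Set.indicator_of_notMem h2,
        Set.indicator_of_mem (Set.mem_Iic.2 (WithBot.coe_le_coe.2 h1)), mul_one, sub_zero]
    · rw [if_neg (fun h => h1 (WithTop.coe_le_coe.1 h)),
        Set.indicator_of_notMem (s := Set.Iic (n : Hhat)) fun h => h1 (WithBot.coe_le_coe.1 h)]
      by_cases h2 : k = n + 1
      · subst h2
        rw [if_pos (by rw [add_sub_cancel_right]), Set.indicator_of_mem (Set.mem_singleton _)]
        ring
      · have h3 : (k : Hhat) ∉ ({((n + 1 : ℤ) : Hhat)} : Set Hhat) := fun h =>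
          h2 (WithBot.coe_injective (Set.mem_singleton_iff.1 h))
        rw [if_neg, Set.indicator_of_notMem h3]
        · ring
        · intro h
          have := WithTop.coe_injective h
          omega

section

variable {φ : Hhat → ℂ} (hφ : ∀ n : ℤ, IntegrableOn φ (Set.Iic (n : Hhat)) plancherel)

include hφ

lemma integral_Iic_eq_add (n : ℤ) : ∫ m in Set.Iic (n : Hhat), φ m ∂plancherel =
    ∫ m in Set.Iic ((n - 1 : ℤ) : Hhat), φ m ∂plancherel +
      (((2 : ℝ) ^ (n - 1) : ℝ) : ℂ) * φ n := by
  rw [Iic_coe_eq_insert, Set.insert_eq, setIntegral_union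
    (Set.disjoint_singleton_left.2 (notMem_Iic_sub_one n)) (Set.to_countable _).measurableSet
    (integrableOn_singleton (by simp) (plancherel_singleton_lt_top _)) (hφ _),
    integral_singleton, measureReal_def, plancherel_singleton,
    ENNReal.toReal_ofReal (by positivity), add_comm, Complex.real_smul]

lemma invFourier_coe (n : ℤ) : invFourier φ n =
    ∫ m in Set.Iic (n : Hhat), φ m ∂plancherel - (((2 : ℝ) ^ n : ℝ) : ℂ) * φ (n + 1 : ℤ) := by
  have m : ∀ s : Set Hhat, MeasurableSet s := fun s => (Set.to_countable s).measurableSet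
  unfold invFourier
  simp_rw [mul_character_eq]
  rw [integral_sub ((hφ n).integrable_indicator (m _))
    ((integrableOn_singleton (by simp) (plancherel_singleton_lt_top _)).integrable_indicator (m _)),
    integral_indicator (m _), integral_indicator (m _), integral_singleton, measureReal_def,
    plancherel_singleton, ENNReal.toReal_ofReal (by positivity), add_sub_cancel_right,
    Complex.real_smul]

/-- The middle sequence is what integrating `c + φˇ` over `U_n` gives formally: `χ_m` is `1` on
`U_n` for `m ≤ n` and has integral zero there for `m > n`. Checking the recursion algebraically
avoids any interchange of integrals. -/
lemma dyadicRecursion_invFourier (c : ℂ) :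
    DyadicRecursion (fun n => c + invFourier φ n)
      (fun n => (((2 : ℝ) ^ (-n) : ℝ) : ℂ) * (c + ∫ m in Set.Iic (n : Hhat), φ m ∂plancherel))
      (fun n => φ n) := by
  have h2 : ∀ n : ℤ, (((2 : ℝ) ^ (-n) : ℝ) : ℂ) * (((2 : ℝ) ^ (n - 1) : ℝ) : ℂ) = 1 / 2 := by
    intro n
    rw [← Complex.ofReal_mul, ← zpow_add₀ two_ne_zero, show -n + (n - 1) = (-1 : ℤ) by ring]
    simp
  have h3 : ∀ n : ℤ, (((2 : ℝ) ^ (-(n - 1)) : ℝ) : ℂ) = 2 * (((2 : ℝ) ^ (-n) : ℝ) : ℂ) := by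
    intro n
    rw [show -(n - 1) = -n + 1 by ring, zpow_add_one₀ two_ne_zero]
    push_cast; ring
  constructor
  · intro n
    have h := h2 n
    simp only [invFourier_coe hφ, integral_Iic_eq_add hφ n, h3, sub_add_cancel]
    ring
  · intro n
    have h := h2 n
    simp only [invFourier_coe hφ, integral_Iic_eq_add hφ n, sub_add_cancel]
    linear_combination (-2 * φ n) * h

lemma tendsto_integral_Iic_neg :
    Tendsto (fun k : ℕ => ∫ m in Set.Iic ((-(k : ℤ) : ℤ) : Hhat), φ m ∂plancherel) atTop
      (𝓝 0) := by
  have h := tendsto_setIntegral_of_antitone (μ := plancherel) (f := φ)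
    (s := fun k : ℕ => Set.Iic ((-(k : ℤ) : ℤ) : Hhat))
    (fun _ => (Set.to_countable _).measurableSet)
    (fun a b hab => Set.Iic_subset_Iic.2 (WithBot.coe_le_coe.2 (by omega))) ⟨0, hφ _⟩
  have e : ⋂ k : ℕ, Set.Iic ((-(k : ℤ) : ℤ) : Hhat) = {⊥} := by
    ext m
    induction m using WithBot.recBotCoe with
    | bot => simp
    | coe j =>
      simp only [Set.mem_iInter, Set.mem_Iic, Set.mem_singleton_iff, WithBot.coe_ne_bot, iff_false,
        not_forall]
      exact ⟨(1 - j).toNat, fun hj => by have := WithBot.coe_le_coe.1 hj; omega⟩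
  rwa [e, integral_singleton, measureReal_def, plancherel_bot, ENNReal.toReal_zero, zero_smul] at h

/-- With `T n` the integral of `φ` over `{m ≤ n}`, the value at `-(k + 1)` is `2 * T (-(k + 1)) - T
(-k)`, and both terms vanish in the limit because `-∞` is a null point. -/
lemma tendsto_invFourier_neg :
    Tendsto (fun k : ℕ => invFourier φ (-((k : ℤ) + 1) : ℤ)) atTop (𝓝 0) := by
  have hT := tendsto_integral_Iic_neg hφ
  have hT1 := hT.comp (tendsto_add_atTop_nat 1)
  have h := (hT1.const_mul 2).sub hT
  simp only [mul_zero, sub_zero] at h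
  refine h.congr fun k => ?_
  have e := integral_Iic_eq_add hφ (-(k : ℤ))
  rw [invFourier_coe hφ, Function.comp_apply]
  rw [show -(k : ℤ) - 1 = -((k : ℤ) + 1) by ring] at e
  rw [show -((k : ℤ) + 1) + 1 = -(k : ℤ) by ring]
  push_cast at e ⊢
  linear_combination -e

end

/-- For `n < 0`, `χ_m(n) ≠ 0` forces `m ≤ n + 1 ≤ 0`. -/
lemma enorm_invFourier_le (φ : Hhat → ℂ) {n : ℤ} (hn : n < 0) :
    ‖invFourier φ n‖ₑ ≤ ∫⁻ m in Set.Iic 0, ‖φ m‖ₑ ∂plancherel := by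
  refine (enorm_integral_le_lintegral_enorm _).trans ?_
  rw [← lintegral_indicator (Set.to_countable _).measurableSet]
  refine lintegral_mono fun m => ?_
  induction m using WithBot.recBotCoe with
  | bot =>
    rw [Set.indicator_of_mem (Set.mem_Iic.2 bot_le)]
    exact (congrArg _ (mul_one _)).le
  | coe k =>
    rw [character_coe, enorm_mul]
    by_cases hk : k ≤ 0
    · rw [Set.indicator_of_mem (s := Set.Iic (0 : Hhat)) (WithBot.coe_le_coe.2 hk)]
      split_ifs <;> simp
    · rw [if_neg, if_neg]
      · simp
      · intro h
        have := WithTop.coe_injective h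
        omega
      · intro h
        have := WithTop.coe_le_coe.1 h
        omega

/-! ### Membership in the amalgam spaces -/

lemma amalgamNorm_one_two_lt_top_iff {X : Type*} [MeasurableSpace X] {μ : Measure X} {B : Set X}
    {f : X → ℂ} : amalgamNorm μ B 1 2 f < ∞ ↔
      eLpNorm f 2 (μ.restrict Bᶜ) < ∞ ∧ eLpNorm f 1 (μ.restrict B) < ∞ := by
  rw [amalgamNorm, if_neg ENNReal.ofNat_ne_top, ENNReal.rpow_lt_top_iff_of_pos (by simp),
    ENNReal.add_lt_top, ENNReal.rpow_lt_top_iff_of_pos (by simp),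
    ENNReal.rpow_lt_top_iff_of_pos (by simp)]

lemma ofReal_mul_norm_sq {w : ℝ} (hw : 0 ≤ w) (z : ℂ) :
    ENNReal.ofReal (w * ‖z‖ ^ 2) = ENNReal.ofReal w * ‖z‖ₑ ^ (2 : ℝ≥0∞).toReal := by
  rw [← ofReal_mul_norm_rpow hw ENNReal.toReal_nonneg, ENNReal.toReal_ofNat, Real.rpow_two]

lemma normH_two_top_lt_top {f : H → ℂ} {c : ℂ} {φ : Hhat → ℂ} (hφ : normHhat 1 2 φ < ∞)
    (hf : ∀ n : ℤ, f n = c + invFourier φ n) : normH 2 ∞ f < ∞ := by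
  obtain ⟨h2, h1⟩ := amalgamNorm_one_two_lt_top_iff.1 hφ
  have hφ0 : IntegrableOn φ (Set.Iic ((0 : ℤ) : Hhat)) plancherel :=
    memLp_one_iff_integrable.1 ⟨(Measurable.of_discrete).aestronglyMeasurable, h1⟩
  have hφi := integrableOn_Iic_of_integrableOn hφ0
  rw [normH, amalgamNorm, if_pos rfl]
  refine max_lt ?_ ?_
  · rw [eLpNorm_exponent_top]
    refine (eLpNormEssSup_le_of_ae_enorm_bound
      (C := ‖c‖ₑ + ∫⁻ m in Set.Iic 0, ‖φ m‖ₑ ∂plancherel)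
      (ae_restrict_haar fun n hn => ?_)).trans_lt ?_
    · rw [hf n]
      refine (enorm_add_le _ _).trans ?_
      gcongr
      exact enorm_invFourier_le φ (not_le.1 fun h => hn (WithTop.coe_le_coe.2 h))
    · rw [eLpNorm_one_eq_lintegral_enorm] at h1
      exact ENNReal.add_lt_top.2 ⟨enorm_lt_top, h1⟩
  · have h2' := eLpNorm_rpow_toReal (plancherel.restrict (Set.Iic 0)ᶜ) φ two_ne_zero
      ENNReal.ofNat_ne_top
    have hlt := ENNReal.rpow_lt_top_of_nonneg (y := (2 : ℝ≥0∞).toReal) (by simp) h2.ne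
    rw [h2', setLIntegral_plancherel_compl] at hlt
    rw [← ENNReal.rpow_lt_top_iff_of_pos (y := (2 : ℝ≥0∞).toReal) (by simp),
      eLpNorm_rpow_toReal _ _ two_ne_zero ENNReal.ofNat_ne_top, setLIntegral_haar_Ici]
    have hrec := dyadicRecursion_invFourier hφi c
    set s0 := (c + ∫ m in Set.Iic ((0 : ℤ) : Hhat), φ m ∂plancherel) with hs0
    refine lt_of_le_of_lt (ENNReal.tsum_le_of_sum_range_le fun L => ?_)
      (ENNReal.add_lt_top.2 ⟨hlt, (ENNReal.ofReal_lt_top (r := ‖s0‖ ^ 2))⟩)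
    -- Parseval from level `L` to level `0`: the boundary term at `L` sits beside the sum over `f`
    -- and is dropped, while the one at `0` is the constant `‖s0‖ ^ 2`.
    have h := hrec.parseval L L
    rw [sum_range_sub_eq_sum_add_one (fun m => (2 : ℝ) ^ (m - 1) * ‖φ m‖ ^ 2),
      sum_range_sub_eq_sum_add_one
        (fun m => (2 : ℝ) ^ (-m) * ‖c + invFourier φ (m - 1 : ℤ)‖ ^ 2)] at h
    simp only [add_sub_cancel_right, sub_self, neg_zero, zpow_zero, one_mul, Complex.ofReal_one,
      ← hf] at h
    have h' := ENNReal.ofReal_le_ofReal ((le_add_of_nonneg_right (by positivity)).trans_eq h.symm)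
    rw [ENNReal.ofReal_add (Finset.sum_nonneg fun _ _ => by positivity) (by positivity),
      ENNReal.ofReal_sum_of_nonneg (fun _ _ => by positivity),
      ENNReal.ofReal_sum_of_nonneg (fun _ _ => by positivity)] at h'
    simp only [ofReal_mul_norm_sq (zpow_nonneg (two_pos (α := ℝ)).le _)] at h'
    refine h'.trans ?_
    gcongr
    exact ENNReal.sum_le_tsum _

lemma memLp_two_Ici_of_memLp {f : H → ℂ} {U : Set H} (hU : U ∈ 𝓝 (⊤ : H))
    (hf : MemLp f 2 (haar.restrict U)) : MemLp f 2 (haar.restrict (Set.Ici 0)) := by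
  obtain ⟨N, hN⟩ := exists_Ici_subset_of_mem_nhds_top hU
  rw [memLp_two_iff_integrable_sq_norm (Measurable.of_discrete).aestronglyMeasurable] at hf ⊢
  exact integrableOn_Ici_of_integrableOn (IntegrableOn.mono_set hf hN) 0

namespace IsPositiveType

variable {f : H → ℂ} (hf : IsPositiveType f)

include hf

lemma integrableOn_fourierH (n : ℤ) :
    IntegrableOn (fourierH f) (Set.Iic (n : Hhat)) plancherel := by
  refine integrableOn_Iic_of_integrableOn (N := 0) ?_ n
  have hi := hf.integrableOn_Ici
  set s : ℤ → ℂ := fun n => ∫ x in Set.Ici (n : H), f x ∂haar with hs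
  -- Positivity turns the norm into the real part, so the weighted coefficients are consecutive
  -- differences of the means over `U_n`, and nonnegativity of the means bounds the telescoped sum
  -- by `(s 0).re`.
  have hnorm : ∀ n : ℤ, (2 : ℝ) ^ (n - 1) * ‖fourierH f n‖ =
      (2 : ℝ) ^ n * (s n).re - (2 : ℝ) ^ (n - 1) * (s (n - 1)).re := by
    intro n
    rw [← Complex.re_eq_norm.2 (hf.fourierH_nonneg n), fourierH_coe hi]
    simp only [hs]
    rw [integral_Ici_sub_one hi, Complex.sub_re, Complex.add_re, zpow_sub_one₀ two_ne_zero n]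
    ring
  refine memLp_one_iff_integrable.1 ⟨(Measurable.of_discrete).aestronglyMeasurable, ?_⟩
  rw [eLpNorm_one_eq_lintegral_enorm, WithBot.coe_zero, setLIntegral_plancherel_Iic]
  refine lt_of_le_of_lt (ENNReal.tsum_le_of_sum_range_le fun L => ?_)
    (ENNReal.ofReal_lt_top (r := (s 0).re))
  have e : ∑ k ∈ Finset.range L, (2 : ℝ) ^ (-(k : ℤ) - 1) * ‖fourierH f (-(k : ℤ) : ℤ)‖ ≤
      (s 0).re := by
    simp_rw [hnorm]
    have h := Finset.sum_range_sub' (fun k : ℕ => (2 : ℝ) ^ (-(k : ℤ)) * (s (-(k : ℤ))).re) L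
    simp only [Nat.cast_add, Nat.cast_one, neg_add' _ (1 : ℤ), Nat.cast_zero, neg_zero, zpow_zero,
      one_mul] at h
    rw [h]
    have : 0 ≤ (s (-(L : ℤ))).re := (Complex.le_def.1 (hf.setIntegral_Ici_nonneg _)).1
    have : 0 ≤ (2 : ℝ) ^ (-(L : ℤ)) * (s (-(L : ℤ))).re := by positivity
    linarith
  refine le_trans (le_of_eq ?_) (ENNReal.ofReal_le_ofReal e)
  rw [ENNReal.ofReal_sum_of_nonneg (fun _ _ => by positivity)]
  refine Finset.sum_congr rfl fun k _ => ?_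
  rw [ENNReal.ofReal_mul (by positivity), ofReal_norm]

/-- A function of positive type is, up to a nonnegative constant, the inverse Fourier transform of
its Fourier transform. -/
lemma exists_eq_const_add_invFourier :
    ∃ c : ℝ, 0 ≤ c ∧ ∀ n : ℤ, f n = c + invFourier (fourierH f) n := by
  have hi := hf.integrableOn_Ici
  have hφ := hf.integrableOn_fourierH
  set m : ℤ → ℂ := fun n => (((2 : ℝ) ^ n : ℝ) : ℂ) * ∫ x in Set.Ici (n : H), f x ∂haar with hm
  set T : ℤ → ℂ := fun n => ∫ k in Set.Iic (n : Hhat), fourierH f k ∂plancherel with hT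
  have h2 : ∀ n : ℤ, (((2 : ℝ) ^ n : ℝ) : ℂ) * (((2 : ℝ) ^ (-n) : ℝ) : ℂ) = 1 := by
    intro n
    rw [← Complex.ofReal_mul, ← zpow_add₀ two_ne_zero]
    simp
  have h3 : ∀ n : ℤ, (((2 : ℝ) ^ n : ℝ) : ℂ) = 2 * (((2 : ℝ) ^ (n - 1) : ℝ) : ℂ) := by
    intro n
    rw [zpow_sub_one₀ two_ne_zero]
    push_cast; ring
  -- The mean `m` and the partial integral `T` both grow by `2 ^ (n - 1) * fourierH f n`.
  have hstep : ∀ n, m n - T n = m (n - 1) - T (n - 1) := by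
    intro n
    simp only [hm, hT]
    rw [integral_Ici_sub_one hi, integral_Iic_eq_add hφ n, fourierH_coe hi, h3 n]
    ring
  have hconst : ∀ n, m n - T n = m 0 - T 0 := by
    intro n
    induction n using Int.induction_on with
    | zero => rfl
    | succ n ih => rw [hstep, add_sub_cancel_right, ih]
    | pred n ih => rw [← hstep, ih]
  -- As `T` tends to `0` at `-∞`, the constant `m - T` is a limit of nonnegative means.
  have hlim : Tendsto (fun k : ℕ => m (-(k : ℤ))) atTop (𝓝 (m 0 - T 0)) := by
    have h := (tendsto_integral_Iic_neg hφ).const_add (m 0 - T 0)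
    rw [add_zero] at h
    refine h.congr fun k => ?_
    rw [← hconst (-(k : ℤ))]
    ring
  have hc : 0 ≤ m 0 - T 0 := ge_of_tendsto' hlim fun k =>
    mul_nonneg (Complex.zero_le_real.2 (by positivity)) (hf.setIntegral_Ici_nonneg _)
  have hc' : (((m 0 - T 0).re : ℝ) : ℂ) = m 0 - T 0 := by
    have := Complex.le_def.1 hc
    exact Complex.ext rfl (by simpa using this.2)
  refine ⟨(m 0 - T 0).re, (Complex.le_def.1 hc).1, fun n => ?_⟩
  rw [hc', invFourier_coe hφ, ← hconst n]
  -- What remains is `f n = 2 ^ n * (s n - F (n + 1))`, the recursion at level `n + 1` solved for `f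
  -- n`.
  have e1 := integral_Ici_sub_one hi (n + 1)
  have e2 := fourierH_coe hi (n + 1)
  rw [add_sub_cancel_right] at e1 e2
  have e3 := h2 (n + 1)
  rw [h3 (n + 1), add_sub_cancel_right] at e3
  simp only [hm, hT]
  rw [e1, e2]
  linear_combination (-f n) * e3

/-- The `ℓ^2` part is Hausdorff–Young on `U_0` at `p = 2`; the `L^1` part holds for every function
of positive type. -/
lemma normHhat_fourierH_lt_top (h : MemLp f 2 (haar.restrict (Set.Ici 0))) :
    normHhat 1 2 (fourierH f) < ∞ := by
  refine amalgamNorm_one_two_lt_top_iff.2 ⟨?_, ?_⟩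
  · have h1 := eLpNorm_fourierH_compl_rpow_add_le hf.integrableOn_Ici
      (ENNReal.HolderConjugate.instTwoTwo) le_rfl ENNReal.ofNat_ne_top
    have h2 := (le_self_add.trans h1).trans_lt
      (ENNReal.rpow_lt_top_of_nonneg (by simp) h.eLpNorm_ne_top)
    exact (ENNReal.rpow_lt_top_iff_of_pos (by simp)).1 h2
  · exact (memLp_one_iff_integrable.2 (hf.integrableOn_fourierH 0)).eLpNorm_lt_top

end IsPositiveType

lemma exists_memLp_two_of_normH_lt_top {f : H → ℂ} (h : normH 2 ∞ f < ∞) :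
    ∃ U ∈ 𝓝 (⊤ : H), MemLp f 2 (haar.restrict U) := by
  rw [normH, amalgamNorm, if_pos rfl] at h
  exact ⟨Set.Ici 0, Ici_mem_nhds (WithTop.coe_lt_top 0),
    (Measurable.of_discrete).aestronglyMeasurable, (le_max_right _ _).trans_lt h⟩

end SpectorHypergroup

open SpectorHypergroup

theorem mainTheorem9 :
    (∀ f : H → ℂ, IsPositiveType f →
      -- the three conditions, up to a constant in the second one
      [ ∃ U ∈ 𝓝 (⊤ : H), MemLp f 2 (haar.restrict U),
        ∃ c : ℝ, 0 ≤ c ∧ ∃ φ : Hhat → ℂ, normHhat 1 2 φ < ∞ ∧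
          f =ᵐ[haar] fun x => (c : ℂ) + invFourier φ x,
        normH 2 ∞ f < ∞ ].TFAE ∧
      -- without a constant, for functions that vanish at infinity
      (Tendsto (fun n : ℤ => f (n : H)) atBot (𝓝 0) →
        [ ∃ U ∈ 𝓝 (⊤ : H), MemLp f 2 (haar.restrict U),
          ∃ φ : Hhat → ℂ, normHhat 1 2 φ < ∞ ∧ f =ᵐ[haar] invFourier φ,
          normH 2 ∞ f < ∞ ].TFAE)) ∧
    -- the Hausdorff-Young property with constant one
    (∀ p q p' q' : ℝ≥0∞, 1 ≤ p → p ≤ 2 → 1 ≤ q → q ≤ 2 →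
      ENNReal.HolderConjugate p p' → ENNReal.HolderConjugate q q' →
      ∀ f : H → ℂ, normHhat q' p' (fourierH f) ≤ normH p q f) := by
  refine ⟨fun f hf => ?_, fun p q p' q' _ hp _ hq hpp hqq f =>
    normHhat_fourierH_le hp hq hpp hqq f⟩
  obtain ⟨c, hc, hfc⟩ := hf.exists_eq_const_add_invFourier
  refine ⟨?_, fun hlim => ?_⟩
  · tfae_have 1 → 2 := by
      rintro ⟨U, hU, hfU⟩
      exact ⟨c, hc, fourierH f, hf.normHhat_fourierH_lt_top (memLp_two_Ici_of_memLp hU hfU),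
        ae_haar_iff.2 hfc⟩
    tfae_have 2 → 3 := by
      rintro ⟨c, -, φ, hφ, hfφ⟩
      exact normH_two_top_lt_top hφ (ae_haar_iff.1 hfφ)
    tfae_have 3 → 1 := exists_memLp_two_of_normH_lt_top
    tfae_finish
  -- Both `f` and its inverse transform part tend to `0` along `-(k + 1)`, which leaves no room for
  -- a constant.
  · have hc0 : (c : ℂ) = 0 := by
      have h1 := (tendsto_invFourier_neg hf.integrableOn_fourierH).const_add (c : ℂ)
      simp_rw [← hfc, add_zero] at h1
      have hbot : Tendsto (fun k : ℕ => (-((k : ℤ) + 1) : ℤ)) atTop atBot :=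
        tendsto_neg_atTop_atBot.comp
          (tendsto_atTop_add_const_right _ 1 tendsto_natCast_atTop_atTop)
      exact tendsto_nhds_unique h1 (hlim.comp hbot)
    tfae_have 1 → 2 := by
      rintro ⟨U, hU, hfU⟩
      refine ⟨fourierH f, hf.normHhat_fourierH_lt_top (memLp_two_Ici_of_memLp hU hfU),
        ae_haar_iff.2 fun n => ?_⟩
      rw [hfc n, hc0, zero_add]
    tfae_have 2 → 3 := by
      rintro ⟨φ, hφ, hfφ⟩
      refine normH_two_top_lt_top (c := 0) hφ fun n => ?_
      rw [zero_add]
      exact ae_haar_iff.1 hfφ n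
    tfae_have 3 → 1 := exists_memLp_two_of_normH_lt_top
    tfae_finish
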